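/- Let $X$ be a Banach space and $(C(t))_{t\in\mathbb R}$ a strongly continuous cosine family of bounded linear operators on $X$, that is, $C(0)=I$, $C(t+s)+C(t-s)=2C(t)C(s)$ for all $s,t\in\mathbb R$, and $t\mapsto C(t)x$ is continuous for every $x\in X$. Let $\mathcal K\ge 1$ be such that $\|C(t)\|\le\mathcal K$ for all $t\in\mathbb R$, and let $S(t)x=\int_0^t C(s)x\,ds$ be the associated sine family. Let $T>0$ and let $\psi:[0,T]\to\mathbb R$ be strictly increasing with continuous derivative $\psi'$ and $\psi'(0)\neq 0$. Let $0<q\le 1$ (for instance $q=\alpha/2$ with $1<\alpha\le 2$), let $$M_q(z)=\sum_{n=0}^{\infty}\frac{(-z)^n}{n!\,\Gamma(1-q(n+1))},\qquad z\ge 0,$$ where $1/\Gamma$ is $0$ at the poles of $\Gamma$, and set $$C_q^\psi(t,0)x=\int_0^\infty M_q(\theta)\,C\big((\psi(t)-\psi(0))^q\theta\big)x\,d\theta,\qquad R_q^\psi(t,0)x=\int_0^t \frac{\psi'(s)}{\psi'(0)}\,C_q^\psi(s,0)x\,ds,$$ $$P_q^\psi(t,s)x=\int_0^\infty q\,\theta\,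 M_q(\theta)\,S\big((\psi(t)-\psi(s))^q\theta\big)x\,d\theta .$$ Then the series defining $M_q(z)$ converges for every $z\ge0$, and for all $x\in X$ and all $0<s\le t\le T$ the three integrals converge (the integrands are Bochner integrable) and 1. $\|C_q^\psi(t,0)x\|\le\mathcal K\|x\|$; 2. $\|R_q^\psi(t,0)x\|\le\mathcal K\|x\|\,\dfrac{\psi(t)-\psi(0)}{\psi'(0)}$; 3. $\|P_q^\psi(t,s)x\|\le\dfrac{\mathcal K(\psi(t)-\psi(s))^q}{\Gamma(2q)}\|x\|$. For $q=1$ the series $M_1$ vanishes identically; in that case the three bounds (and the convergence of the integral in 2) also hold when $M_1(\theta)\,d\theta$ is read as the Dirac mass at $\theta=1$, i.e. for $C(\psi(t)-\psi(0))x$, $\int_0^t\frac{\psi'(s)}{\psi'(0)}C(\psi(s)-\psi(0))x\,ds$ and $S(\psi(t)-\psi(s))x$ in place of $C_1^\psi(t,0)x$, $R_1^\psi(t,0)x$ and $P_1^\psi(t,s)x$. -/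

import Mathlib

open Set MeasureTheory

noncomputable section

/-- A strongly continuous cosine family of bounded linear operators on `X`. Only real linearity is
required; a family of complex linear operators on a complex space is in particular of this kind. -/
structure IsCosineFamily {X : Type*} [NormedAddCommGroup X] [NormedSpace ℝ X]
    (C : ℝ → X →L[ℝ] X) : Prop where
  zero : C 0 = ContinuousLinearMap.id ℝ X
  add_add_sub : ∀ s t : ℝ, C (t + s) + C (t - s) = (2 : ℝ) • (C t ∘L C s)
  continuous_apply : ∀ x : X, Continuous fun t => C t x

/-- The associated sine family `S(t) x = ∫₀ᵗ C(s) x ds`. -/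
def sineFamily {X : Type*} [NormedAddCommGroup X] [NormedSpace ℝ X]
    (C : ℝ → X →L[ℝ] X) (t : ℝ) (x : X) : X :=
  ∫ s in (0 : ℝ)..t, C s x

/-- The `n`-th term `(-z)ⁿ / (n! Γ(1 - q (n + 1)))` of Mainardi's Wright-type function. At a pole of
`Γ` the term is `0`, in agreement with the usual convention `1 / Γ = 0` there. -/
def mainardiTerm (q z : ℝ) (n : ℕ) : ℝ :=
  (-z) ^ n / ((n.factorial : ℝ) * Real.Gamma (1 - q * ((n : ℝ) + 1)))

/-- Mainardi's Wright-type function `M_q`. -/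
def mainardi (q z : ℝ) : ℝ :=
  ∑' n : ℕ, mainardiTerm q z n

/-- `C_q^ψ(t,0) x = ∫₀^∞ M_q(θ) C((ψ(t) - ψ(0))^q θ) x dθ`. -/
def psiC {X : Type*} [NormedAddCommGroup X] [NormedSpace ℝ X]
    (C : ℝ → X →L[ℝ] X) (ψ : ℝ → ℝ) (q t : ℝ) (x : X) : X :=
  ∫ θ in Ioi (0 : ℝ), mainardi q θ • C ((ψ t - ψ 0) ^ q * θ) x

/-- `R_q^ψ(t,0) x = ∫₀ᵗ (ψ'(s) / ψ'(0)) C_q^ψ(s,0) x ds`, where `ψ'` is the derivative of `ψ`. -/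
def psiR {X : Type*} [NormedAddCommGroup X] [NormedSpace ℝ X]
    (C : ℝ → X →L[ℝ] X) (ψ ψ' : ℝ → ℝ) (q t : ℝ) (x : X) : X :=
  ∫ s in (0 : ℝ)..t, (ψ' s / ψ' 0) • psiC C ψ q s x

/-- `P_q^ψ(t,s) x = ∫₀^∞ q θ M_q(θ) S((ψ(t) - ψ(s))^q θ) x dθ`. -/
def psiP {X : Type*} [NormedAddCommGroup X] [NormedSpace ℝ X]
    (C : ℝ → X →L[ℝ] X) (ψ : ℝ → ℝ) (q t s : ℝ) (x : X) : X :=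
  ∫ θ in Ioi (0 : ℝ), (q * θ * mainardi q θ) • sineFamily C ((ψ t - ψ s) ^ q * θ) x

end

/-! For `q < 1` everything rests on two facts about `M_q`: it is nonnegative on `[0, ∞)`, and `∫ θ^m
M_q(θ) dθ = m! / Γ(qm + 1)`. The zeroth moment is `1`, which bounds `C_q`. Since `‖S(τ)x‖ ≤ K τ
‖x‖`, the bound for `P_q` uses `q` times the second moment, and that is `1 / Γ(2q)`. The bound for
`R_q` follows because `ψ' ≥ 0` integrates to `ψ(t) - ψ(0)`.

To reach these facts, the reflection formula turns `1 / Γ(1 - q(n+1))` into `Γ(q(n+1)) sin(πq(n+1))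
/ π`, and Euler's integral then writes `M_q` as a difference of integrals over two conjugate rays
(`hasSum_mainardiTerm`). This gives continuity, decay `O(1/z)` and the Mellin transform `Γ(δ) / Γ(1
- q(1-δ))` on `0 < Re δ < 1`. Comparing Mellin transforms in `x` proves `∫ e^{-lt} t^{-q} M_q(x
t^{-q}) dt = l^{q-1} e^{-x l^q}` (`laplace_mainardi`).

The right side is completely monotone in `l`, so Post–Widder inversion at `t = 1` gives `M_q(x) ≥
0`. Multiplying the identity at `l = 1` by `x^m` and applying Tonelli gives the moments. For `q = 1`
the series is zero and the Dirac versions are estimated directly. -/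

/-! ### Gamma integrals with complex rate and Mellin transforms of dilates -/

theorem integrableOn_rpow_sub_one_mul_exp {σ c : ℝ} (hσ : 0 < σ) (hc : 0 < c) :
    IntegrableOn (fun t : ℝ => t ^ (σ - 1) * Real.exp (-(c * t))) (Ioi 0) := by
  have h := integrableOn_rpow_mul_exp_neg_mul_rpow (p := 1) (s := σ - 1) (b := c)
    (by linarith) one_pos hc
  simpa using h

theorem continuousOn_ofReal_cpow (s : ℂ) :
    ContinuousOn (fun t : ℝ => (t : ℂ) ^ s) (Ioi 0) := fun t ht =>
  (Complex.continuousAt_ofReal_cpow_const t s (Or.inr (ne_of_gt ht))).continuousWithinAt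

theorem norm_cpow_mul_exp {s b : ℂ} {t : ℝ} (ht : 0 < t) :
    ‖(t : ℂ) ^ (s - 1) * Complex.exp (-(b * t))‖ = t ^ (s.re - 1) * Real.exp (-(b.re * t)) := by
  rw [norm_mul, Complex.norm_cpow_eq_rpow_re_of_pos ht, Complex.norm_exp]
  simp

theorem aestronglyMeasurable_cpow_mul_exp (s b : ℂ) :
    AEStronglyMeasurable (fun t : ℝ => (t : ℂ) ^ (s - 1) * Complex.exp (-(b * t)))
      (volume.restrict (Ioi 0)) :=
  ((continuousOn_ofReal_cpow _).mul (by fun_prop)).aestronglyMeasurable measurableSet_Ioi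

theorem integrableOn_cpow_mul_exp {s b : ℂ} (hs : 0 < s.re) (hb : 0 < b.re) :
    IntegrableOn (fun t : ℝ => (t : ℂ) ^ (s - 1) * Complex.exp (-(b * t))) (Ioi 0) := by
  refine (integrableOn_rpow_sub_one_mul_exp hs hb).mono' (aestronglyMeasurable_cpow_mul_exp s b) ?_
  filter_upwards [ae_restrict_mem measurableSet_Ioi] with t ht
  exact (norm_cpow_mul_exp ht).le

theorem differentiableOn_integral_cpow_mul_exp {s : ℂ} (hs : 0 < s.re) :
    DifferentiableOn ℂ (fun b : ℂ => ∫ t : ℝ in Ioi 0, (t : ℂ) ^ (s - 1) * Complex.exp (-(b * t)))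
      {b | 0 < b.re} := by
  intro b hb
  have hb' : 0 < b.re / 2 := half_pos hb
  have key := hasDerivAt_integral_of_dominated_loc_of_deriv_le (𝕜 := ℂ)
    (μ := volume.restrict (Ioi (0 : ℝ)))
    (F := fun (b : ℂ) (t : ℝ) => (t : ℂ) ^ (s - 1) * Complex.exp (-(b * t)))
    (F' := fun (b : ℂ) (t : ℝ) => (t : ℂ) ^ (s - 1) * (Complex.exp (-(b * t)) * (-t)))
    (bound := fun t : ℝ => t ^ (s.re + 1 - 1) * Real.exp (-(b.re / 2 * t)))
    (x₀ := b) (s := {z : ℂ | b.re / 2 < z.re})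
    ((isOpen_lt continuous_const Complex.continuous_re).mem_nhds (by simp; linarith))
    (Filter.Eventually.of_forall fun z => aestronglyMeasurable_cpow_mul_exp s z)
    (integrableOn_cpow_mul_exp hs hb)
    (((continuousOn_ofReal_cpow _).mul (by fun_prop)).aestronglyMeasurable measurableSet_Ioi)
    ?_ (integrableOn_rpow_sub_one_mul_exp (by linarith) hb') ?_
  · exact key.2.differentiableAt.differentiableWithinAt
  · filter_upwards [ae_restrict_mem measurableSet_Ioi] with t ht z hz
    have ht' : 0 < t := ht
    rw [← mul_assoc, norm_mul, norm_cpow_mul_exp ht, norm_neg, Complex.norm_real,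
      Real.norm_of_nonneg ht'.le, mul_right_comm, ← Real.rpow_add_one ht'.ne']
    have hz' : b.re / 2 < z.re := hz
    have : -(z.re * t) ≤ -(b.re / 2 * t) := by nlinarith
    rw [show s.re - 1 + 1 = s.re + 1 - 1 by ring]
    gcongr
  · refine Filter.Eventually.of_forall fun t z _ => ?_
    refine HasDerivAt.const_mul _ ?_
    have := ((hasDerivAt_id z).mul_const (t : ℂ)).neg.cexp
    simpa using this

/-- The Gamma integral with a complex rate. -/
theorem integral_cpow_mul_exp {s b : ℂ} (hs : 0 < s.re) (hb : 0 < b.re) :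
    ∫ t : ℝ in Ioi 0, (t : ℂ) ^ (s - 1) * Complex.exp (-(b * t)) =
      b ^ (-s) * Complex.Gamma s := by
  have hopen : IsOpen {b : ℂ | 0 < b.re} := isOpen_lt continuous_const Complex.continuous_re
  have hconv : Convex ℝ {b : ℂ | 0 < b.re} := convex_halfSpace_re_gt 0
  have hf := (differentiableOn_integral_cpow_mul_exp hs).analyticOnNhd hopen
  have hg : AnalyticOnNhd ℂ (fun b : ℂ => b ^ (-s) * Complex.Gamma s) {b | 0 < b.re} := by
    refine DifferentiableOn.analyticOnNhd (fun z hz => ?_) hopen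
    have : z ∈ Complex.slitPlane := Or.inl hz
    exact ((differentiableAt_id.cpow_const this).mul_const _).differentiableWithinAt
  -- Identity theorem: both sides are analytic in the rate on the right half-plane and agree at the
  -- real points `1 + 1/(n+1)`, which accumulate at `1`.
  refine hf.eqOn_of_preconnected_of_frequently_eq hg hconv.isPreconnected (z₀ := 1) (by simp) ?_ hb
  have hlim : Filter.Tendsto (fun n : ℕ => ((1 + 1 / ((n : ℝ) + 1) : ℝ) : ℂ)) Filter.atTop
      (nhdsWithin 1 {1}ᶜ) := by
    refine tendsto_nhdsWithin_iff.2 ⟨?_, Filter.Eventually.of_forall fun n => ?_⟩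
    · have := (tendsto_one_div_add_atTop_nhds_zero_nat (𝕜 := ℝ)).const_add 1
      have h2 := (Complex.continuous_ofReal.tendsto _).comp this
      simpa [Function.comp_def] using h2
    · have : (0 : ℝ) < 1 / ((n : ℝ) + 1) := by positivity
      simp only [mem_compl_iff, mem_singleton_iff]
      intro h
      have h' : (1 + 1 / ((n : ℝ) + 1) : ℝ) = 1 := by exact_mod_cast h
      linarith
  refine hlim.frequently (Filter.Eventually.of_forall fun n => ?_).frequently
  have hr : (0 : ℝ) < 1 + 1 / ((n : ℝ) + 1) := by positivity
  generalize 1 + 1 / ((n : ℝ) + 1) = r at hr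
  rw [Complex.integral_cpow_mul_exp_neg_mul_Ioi hs hr, one_div, ← Complex.ofReal_inv,
    Complex.cpow_neg, Complex.ofReal_inv, Complex.inv_cpow]
  rw [Complex.arg_ofReal_of_nonneg hr.le]
  exact Real.pi_pos.ne

/-- The Mellin transform of a superposition of dilates. -/
theorem hasMellin_integral_comp_mul {k g : ℝ → ℂ} {p : ℝ} {δ : ℂ}
    (hk : ContinuousOn k (Ioi 0)) (hg : ContinuousOn g (Ioi 0)) (hgm : MellinConvergent g δ)
    (hkm : IntegrableOn (fun r : ℝ => k r * (r : ℂ) ^ (-(p * δ))) (Ioi 0)) :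
    HasMellin (fun z : ℝ => ∫ r in Ioi (0 : ℝ), k r * g (z * r ^ p)) δ
      (mellin g δ * ∫ r in Ioi (0 : ℝ), k r * (r : ℂ) ^ (-(p * δ))) := by
  have hpow : ∀ r : ℝ, 0 < r → (((r ^ p : ℝ) : ℂ)) ^ (-δ) = (r : ℂ) ^ (-(p * δ)) := by
    intro r hr
    have hrp := Real.rpow_pos_of_pos hr p
    rw [Complex.cpow_def_of_ne_zero (by exact_mod_cast hrp.ne'),
      Complex.cpow_def_of_ne_zero (by exact_mod_cast hr.ne'), ← Complex.ofReal_log hrp.le,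
      ← Complex.ofReal_log hr.le, Real.log_rpow hr]
    push_cast
    ring_nf
  have hmeas : AEStronglyMeasurable
      (fun x : ℝ × ℝ => k x.1 * ((x.2 : ℂ) ^ (δ - 1) * g (x.2 * x.1 ^ p)))
      ((volume.restrict (Ioi (0 : ℝ))).prod (volume.restrict (Ioi (0 : ℝ)))) := by
    rw [Measure.prod_restrict]
    refine ContinuousOn.aestronglyMeasurable ?_ (measurableSet_Ioi.prod measurableSet_Ioi)
    refine (hk.comp continuousOn_fst fun x hx => hx.1).mul
      (((continuousOn_ofReal_cpow _).comp continuousOn_snd fun x hx => hx.2).mul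
        (hg.comp (continuousOn_snd.mul
          (continuousOn_fst.rpow_const fun x hx => Or.inl (ne_of_gt hx.1))) fun x hx => ?_))
    exact mul_pos hx.2 (Real.rpow_pos_of_pos hx.1 _)
  have hnorm : ∀ r : ℝ, 0 < r →
      ∫ z in Ioi (0 : ℝ), ‖k r * ((z : ℂ) ^ (δ - 1) * g (z * r ^ p))‖ =
        ‖k r * (r : ℂ) ^ (-(p * δ))‖ * ∫ z in Ioi (0 : ℝ), ‖(z : ℂ) ^ (δ - 1) * g z‖ := by
    intro r hr
    have hrp : 0 < r ^ p := Real.rpow_pos_of_pos hr p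
    -- The integral of norms is the Mellin transform of `‖g‖` at the real point `Re δ`, so the
    -- dilation rule computes it; this is the bound Fubini needs.
    have h := mellin_comp_mul_left (fun z => ((‖g z‖ : ℝ) : ℂ)) (δ.re : ℂ) hrp
    have e : ∀ G : ℝ → ℂ, mellin (fun z => ((‖G z‖ : ℝ) : ℂ)) (δ.re : ℂ) =
        ((∫ z in Ioi (0 : ℝ), ‖(z : ℂ) ^ (δ - 1) * G z‖ : ℝ) : ℂ) := by
      intro G
      rw [mellin, ← integral_complex_ofReal]
      refine setIntegral_congr_fun measurableSet_Ioi fun z hz => ?_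
      simp only [smul_eq_mul, norm_mul, Complex.norm_cpow_eq_rpow_re_of_pos hz]
      push_cast
      rw [Complex.ofReal_cpow (le_of_lt hz)]
      simp
    have h1 := e (fun z => g (r ^ p * z))
    rw [h1, e, smul_eq_mul, show (-(δ.re : ℂ)) = ((-δ.re : ℝ) : ℂ) by simp,
      ← Complex.ofReal_cpow hrp.le, ← Complex.ofReal_mul] at h
    have h' := Complex.ofReal_injective h
    simp_rw [norm_mul (k r), integral_const_mul]
    rw [show (fun z : ℝ => ‖(z : ℂ) ^ (δ - 1) * g (z * r ^ p)‖) =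
      fun z : ℝ => ‖(z : ℂ) ^ (δ - 1) * g (r ^ p * z)‖ by simp_rw [mul_comm (r ^ p)], h',
      ← hpow r hr, Complex.norm_cpow_eq_rpow_re_of_pos hrp]
    simp [mul_assoc]
  have hconv : ∀ r : ℝ, 0 < r →
      IntegrableOn (fun z : ℝ => (z : ℂ) ^ (δ - 1) * g (z * r ^ p)) (Ioi 0) := by
    intro r hr
    have := (MellinConvergent.comp_mul_left (Real.rpow_pos_of_pos hr p)).2 hgm
    simpa [MellinConvergent, mul_comm] using this
  have hint : Integrable
      (fun x : ℝ × ℝ => k x.1 * ((x.2 : ℂ) ^ (δ - 1) * g (x.2 * x.1 ^ p)))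
      ((volume.restrict (Ioi (0 : ℝ))).prod (volume.restrict (Ioi (0 : ℝ)))) := by
    rw [integrable_prod_iff hmeas]
    constructor
    · filter_upwards [ae_restrict_mem measurableSet_Ioi] with r hr
      exact (hconv r hr).const_mul _
    · refine (hkm.norm.mul_const
        (∫ z in Ioi (0 : ℝ), ‖(z : ℂ) ^ (δ - 1) * g z‖)).congr ?_
      filter_upwards [ae_restrict_mem measurableSet_Ioi] with r hr
      exact (hnorm r hr).symm
  have hpull : ∀ z : ℝ, (z : ℂ) ^ (δ - 1) • ∫ r in Ioi (0 : ℝ), k r * g (z * r ^ p) =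
      ∫ r in Ioi (0 : ℝ), k r * ((z : ℂ) ^ (δ - 1) * g (z * r ^ p)) := by
    intro z
    rw [smul_eq_mul, ← integral_const_mul]
    congr 1
    ext r
    ring
  constructor
  · refine hint.integral_prod_right.congr (Filter.Eventually.of_forall fun z => ?_)
    exact (hpull z).symm
  · rw [mellin]
    simp_rw [hpull]
    rw [← integral_integral_swap hint, ← integral_const_mul]
    refine setIntegral_congr_fun measurableSet_Ioi fun r hr => ?_
    have h := mellin_comp_mul_left g δ (Real.rpow_pos_of_pos hr p)
    simp only [mellin, smul_eq_mul] at h ⊢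
    rw [integral_const_mul]
    simp_rw [mul_comm _ (r ^ p)]
    rw [h, hpow r hr]
    ring

/-! ### Complete monotonicity up to a finite order -/

/-- `F` is nonnegative on `(0, ∞)` and so are its first `n` derivatives with alternating signs. -/
def IsCompletelyMonotoneUpTo : ℕ → (ℝ → ℝ) → Prop
  | 0, F => ∀ x > 0, 0 ≤ F x
  | n + 1, F => (∀ x > 0, 0 ≤ F x) ∧
      ∃ G, IsCompletelyMonotoneUpTo n G ∧ ∀ x > 0, HasDerivAt F (-(G x)) x

namespace IsCompletelyMonotoneUpTo

theorem of_succ {n : ℕ} {F : ℝ → ℝ} (h : IsCompletelyMonotoneUpTo (n + 1) F) :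
    IsCompletelyMonotoneUpTo n F := by
  induction n generalizing F with
  | zero => exact h.1
  | succ n ih =>
    obtain ⟨h0, G, hG, hd⟩ := h
    exact ⟨h0, G, ih hG, hd⟩

theorem congr {n : ℕ} {F G : ℝ → ℝ} (h : IsCompletelyMonotoneUpTo n F)
    (hFG : ∀ x > 0, F x = G x) : IsCompletelyMonotoneUpTo n G := by
  cases n with
  | zero => exact fun x hx => hFG x hx ▸ h x hx
  | succ n =>
    obtain ⟨h0, F', hF', hd⟩ := h
    refine ⟨fun x hx => hFG x hx ▸ h0 x hx, F', hF', fun x hx => (hd x hx).congr_of_eventuallyEq ?_⟩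
    filter_upwards [Ioi_mem_nhds hx] with y hy
    exact (hFG y hy).symm

theorem add {n : ℕ} {F G : ℝ → ℝ} (hF : IsCompletelyMonotoneUpTo n F)
    (hG : IsCompletelyMonotoneUpTo n G) : IsCompletelyMonotoneUpTo n (fun x => F x + G x) := by
  induction n generalizing F G with
  | zero => exact fun x hx => add_nonneg (hF x hx) (hG x hx)
  | succ n ih =>
    obtain ⟨hF0, F', hF', hFd⟩ := hF
    obtain ⟨hG0, G', hG', hGd⟩ := hG
    refine ⟨fun x hx => add_nonneg (hF0 x hx) (hG0 x hx), _, ih hF' hG', fun x hx => ?_⟩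
    convert! (hFd x hx).add (hGd x hx) using 1
    ring

/-- By Leibniz, `F' G + F G'` pairs a derivative of order `n` with an undifferentiated factor, which
is also needed at order `n`; hence `of_succ`. -/
theorem mul {n : ℕ} {F G : ℝ → ℝ} (hF : IsCompletelyMonotoneUpTo n F)
    (hG : IsCompletelyMonotoneUpTo n G) : IsCompletelyMonotoneUpTo n (fun x => F x * G x) := by
  induction n generalizing F G with
  | zero => exact fun x hx => mul_nonneg (hF x hx) (hG x hx)
  | succ n ih =>
    have hFn := hF.of_succ
    have hGn := hG.of_succ
    obtain ⟨hF0, F', hF', hFd⟩ := hF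
    obtain ⟨hG0, G', hG', hGd⟩ := hG
    refine ⟨fun x hx => mul_nonneg (hF0 x hx) (hG0 x hx), _, (ih hF' hGn).add (ih hFn hG'),
      fun x hx => ?_⟩
    convert! (hFd x hx).mul (hGd x hx) using 1
    ring

theorem zero_fun (n : ℕ) : IsCompletelyMonotoneUpTo n (fun _ => 0) := by
  induction n with
  | zero => exact fun x _ => le_rfl
  | succ n ih => exact ⟨fun x _ => le_rfl, _, ih, fun x _ => by simpa using hasDerivAt_const x 0⟩

theorem const {c : ℝ} (hc : 0 ≤ c) (n : ℕ) : IsCompletelyMonotoneUpTo n (fun _ => c) := by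
  cases n with
  | zero => exact fun x _ => hc
  | succ n =>
    exact ⟨fun x _ => hc, _, zero_fun n, fun x _ => by simpa using hasDerivAt_const x c⟩

theorem rpow {a : ℝ} (ha : a ≤ 0) (n : ℕ) : IsCompletelyMonotoneUpTo n (fun x => x ^ a) := by
  induction n generalizing a with
  | zero => exact fun x hx => Real.rpow_nonneg hx.le a
  | succ n ih =>
    refine ⟨fun x hx => Real.rpow_nonneg hx.le a, _,
      (const (neg_nonneg.2 ha) n).mul (ih (a := a - 1) (by linarith)), fun x hx => ?_⟩
    convert! Real.hasDerivAt_rpow_const (p := a) (Or.inl hx.ne') using 1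
    ring

/-- Minus the derivative is `y q x^(q-1)` times the function itself, and `x^(q-1)` is completely
monotone because `q ≤ 1`; the induction closes through products. -/
theorem exp_neg_mul_rpow {q y : ℝ} (hq0 : 0 ≤ q) (hq1 : q ≤ 1) (hy : 0 ≤ y) (n : ℕ) :
    IsCompletelyMonotoneUpTo n (fun x => Real.exp (-(y * x ^ q))) := by
  induction n with
  | zero => exact fun x _ => (Real.exp_pos _).le
  | succ n ih =>
    refine ⟨fun x _ => (Real.exp_pos _).le, _,
      ((const (mul_nonneg hy hq0) n).mul (rpow (a := q - 1) (by linarith) n)).mul ih,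
      fun x hx => ?_⟩
    convert! ((Real.hasDerivAt_rpow_const (p := q) (Or.inl hx.ne')).const_mul y).neg.exp using 1
    simp only [Pi.neg_apply]
    ring

end IsCompletelyMonotoneUpTo

/-! ### Sign of a function from its Laplace transform -/

section Laplace

variable {f : ℝ → ℝ} {B : ℝ}

theorem hasDerivAt_laplace (hf : ContinuousOn f (Ioi 0)) (hB : ∀ t > 0, |f t| ≤ B) (n : ℕ)
    {l : ℝ} (hl : 0 < l) :
    HasDerivAt (fun l : ℝ => ∫ t in Ioi (0 : ℝ), t ^ n * Real.exp (-(l * t)) * f t)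
      (-∫ t in Ioi (0 : ℝ), t ^ (n + 1) * Real.exp (-(l * t)) * f t) l := by
  have hmeas : ∀ (m : ℕ) (l : ℝ), AEStronglyMeasurable
      (fun t : ℝ => t ^ m * Real.exp (-(l * t)) * f t) (volume.restrict (Ioi 0)) := fun m l =>
    (ContinuousOn.mul (by fun_prop) hf).aestronglyMeasurable measurableSet_Ioi
  have hdom : ∀ (m : ℕ) (l : ℝ), 0 < l →
      IntegrableOn (fun t : ℝ => t ^ m * Real.exp (-(l * t)) * B) (Ioi 0) := by
    intro m l hl
    have := (integrableOn_rpow_sub_one_mul_exp (σ := m + 1) (by positivity) hl).mul_const B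
    simpa [IntegrableOn] using this
  have hbound : ∀ (m : ℕ) (l t : ℝ), 0 < t →
      ‖t ^ m * Real.exp (-(l * t)) * f t‖ ≤ t ^ m * Real.exp (-(l * t)) * B := by
    intro m l t ht
    rw [norm_mul, Real.norm_of_nonneg (by positivity)]
    exact mul_le_mul_of_nonneg_left (hB t ht) (by positivity)
  have key := hasDerivAt_integral_of_dominated_loc_of_deriv_le (𝕜 := ℝ)
    (μ := volume.restrict (Ioi (0 : ℝ)))
    (F := fun (l t : ℝ) => t ^ n * Real.exp (-(l * t)) * f t)
    (F' := fun (l t : ℝ) => -(t ^ (n + 1) * Real.exp (-(l * t)) * f t))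
    (bound := fun t : ℝ => t ^ (n + 1) * Real.exp (-(l / 2 * t)) * B)
    (x₀ := l) (s := Ioi (l / 2)) (Ioi_mem_nhds (by linarith))
    (Filter.Eventually.of_forall fun z => hmeas n z)
    ((hdom n l hl).mono' (hmeas n l) ?_) (hmeas (n + 1) l).neg ?_ (hdom _ _ (half_pos hl)) ?_
  · rw [← integral_neg]
    exact key.2
  · filter_upwards [ae_restrict_mem measurableSet_Ioi] with t ht using hbound n l t ht
  · filter_upwards [ae_restrict_mem measurableSet_Ioi] with t ht z hz
    have ht' : 0 < t := ht
    have hz' : l / 2 < z := hz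
    rw [norm_neg]
    refine (hbound _ _ t ht).trans ?_
    have hB0 : 0 ≤ B := (abs_nonneg _).trans (hB t ht)
    have : -(z * t) ≤ -(l / 2 * t) := by nlinarith
    gcongr
  · refine Filter.Eventually.of_forall fun t z _ => ?_
    have := (((hasDerivAt_id z).mul_const t).neg.exp.const_mul (t ^ n)).mul_const (f t)
    convert! this using 1
    simp only [Pi.neg_apply, id_eq]
    ring

/-- Each differentiation in `l` brings down `-t`, so `n` alternating derivatives raise the power
from `m` to `m + n`. Uniqueness of derivatives identifies the witness `G` with the next moment. -/
theorem laplace_moment_nonneg (hf : ContinuousOn f (Ioi 0)) (hB : ∀ t > 0, |f t| ≤ B)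
    {n m : ℕ} (h : IsCompletelyMonotoneUpTo n
      (fun l : ℝ => ∫ t in Ioi (0 : ℝ), t ^ m * Real.exp (-(l * t)) * f t)) {l : ℝ} (hl : 0 < l) :
    0 ≤ ∫ t in Ioi (0 : ℝ), t ^ (m + n) * Real.exp (-(l * t)) * f t := by
  induction n generalizing m with
  | zero => exact h l hl
  | succ n ih =>
    obtain ⟨-, G, hG, hd⟩ := h
    rw [← add_assoc, add_right_comm]
    refine ih (hG.congr fun x hx => ?_)
    exact neg_injective ((hd x hx).unique (hasDerivAt_laplace hf hB m hx))

/-- `1/e` is the unique maximum point of `-u log u`: apply `1 + v < e^v` with `v = -1 - log u`. -/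
theorem negMulLog_lt_exp_neg_one {u : ℝ} (hu : 0 ≤ u) (hne : u ≠ Real.exp (-1)) :
    Real.negMulLog u < Real.exp (-1) := by
  rcases hu.eq_or_lt with rfl | hu
  · simpa using Real.exp_pos _
  · have h1 : -1 - Real.log u ≠ 0 := by
      intro h
      apply hne
      rw [show (-1 : ℝ) = Real.log u by linarith, Real.exp_log hu]
    have h2 := Real.add_one_lt_exp h1
    rw [Real.exp_sub, Real.exp_log hu, lt_div_iff₀ hu] at h2
    rw [Real.negMulLog]
    linarith

/-- Substitute `u = e^{-t}`: of the `n + 1` exponential factors, `n` join `t^n` to form `(-u log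
u)^n` and the last is the Jacobian. -/
theorem integral_pow_mul_exp_eq_negMulLog (f : ℝ → ℝ) (n : ℕ) :
    ∫ t in Ioi (0 : ℝ), t ^ n * Real.exp (-((n + 1 : ℝ) * t)) * f t =
      ∫ u in Icc (0 : ℝ) 1, Real.negMulLog u ^ n • f (-Real.log u) := by
  have himg : (fun t : ℝ => Real.exp (-t)) '' Ioi 0 = Ioo 0 1 := by
    ext u
    constructor
    · rintro ⟨t, ht, rfl⟩
      exact ⟨Real.exp_pos _, by simpa using ht⟩
    · rintro ⟨h0, h1⟩
      exact ⟨-Real.log u, by simpa using Real.log_neg h0 h1, by simp [Real.exp_log h0]⟩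
  have hder : ∀ t ∈ Ioi (0 : ℝ),
      HasDerivWithinAt (fun t : ℝ => Real.exp (-t)) (-Real.exp (-t)) (Ioi 0) t := fun t _ => by
    simpa using ((hasDerivAt_id t).neg.exp).hasDerivWithinAt
  rw [integral_Icc_eq_integral_Ioo, ← himg,
    integral_image_eq_integral_abs_deriv_smul measurableSet_Ioi hder
      (fun a _ b _ h => by simpa using h)]
  refine setIntegral_congr_fun measurableSet_Ioi fun t _ => ?_
  simp only [Real.negMulLog, Real.log_exp, neg_neg, abs_neg, abs_of_pos (Real.exp_pos _),
    smul_eq_mul]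
  rw [show -((n + 1 : ℝ) * t) = n * (-t) + -t by ring, Real.exp_add, Real.exp_nat_mul]
  ring

/-- The inversion formula of Post and Widder, reduced to its sign. -/
theorem nonneg_at_one_of_laplace_moment_nonneg (hf : ContinuousOn f (Ioi 0))
    (hB : ∀ t > 0, |f t| ≤ B)
    (h : ∀ n : ℕ, 0 ≤ ∫ t in Ioi (0 : ℝ), t ^ n * Real.exp (-((n + 1 : ℝ) * t)) * f t) :
    0 ≤ f 1 := by
  have hmem : Real.exp (-1) ∈ Ioo (0 : ℝ) 1 := ⟨Real.exp_pos _, by simp⟩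
  have hg : ContinuousOn (fun u : ℝ => f (-Real.log u)) (Ioo 0 1) := by
    refine hf.comp (Real.continuousOn_log.neg.mono fun u hu => ne_of_gt hu.1) fun u hu => ?_
    simpa using Real.log_neg hu.1 hu.2
  have hint : IntegrableOn (fun u : ℝ => f (-Real.log u)) (Icc 0 1) := by
    rw [integrableOn_Icc_iff_integrableOn_Ioo]
    refine Integrable.mono' (g := fun _ => B) (by simp)
      (hg.aestronglyMeasurable measurableSet_Ioo) ?_
    filter_upwards [ae_restrict_mem measurableSet_Ioo] with u hu
    exact hB _ (by simpa using Real.log_neg hu.1 hu.2)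
  -- Powers of `-u log u` concentrate at `u = 1/e`, that is at `t = 1`, so the normalised integrals
  -- tend to `f 1`; each of them is nonnegative.
  have key := tendsto_setIntegral_pow_smul_of_unique_maximum_of_isCompact_of_integrableOn
    (μ := volume) (s := Icc (0 : ℝ) 1) (x₀ := Real.exp (-1)) isCompact_Icc
    (c := Real.negMulLog) Real.continuous_negMulLog.continuousOn
    (fun y hy hne => by
      simpa [Real.negMulLog] using negMulLog_lt_exp_neg_one hy.1 hne)
    (fun x hx => Real.negMulLog_nonneg hx.1 hx.2)
    (by simpa [Real.negMulLog] using Real.exp_pos _)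
    (by rw [interior_Icc]; exact subset_closure hmem) hint
    ((hg.continuousAt (isOpen_Ioo.mem_nhds hmem)).continuousWithinAt)
  simp only [Real.log_exp, neg_neg] at key
  refine ge_of_tendsto' key fun n => ?_
  refine smul_nonneg (inv_nonneg.2 ?_) ?_
  · exact setIntegral_nonneg measurableSet_Icc fun x hx =>
      pow_nonneg (Real.negMulLog_nonneg hx.1 hx.2) n
  · rw [← integral_pow_mul_exp_eq_negMulLog]
    exact h n

end Laplace

/-! ### Integrals over rays -/

section Ray

open Complex in
/-- The integral of `exp (s - z s ^ q) s ^ (q - 1)` over a ray, up to normalisation: on it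
`s = -exp (-i a) r` and `s ^ q = exp (i a) r ^ q`. -/
noncomputable def rayIntegral (q a z : ℝ) : ℂ :=
  ∫ r in Ioi (0 : ℝ), ((r : ℂ) ^ ((q : ℂ) - 1) * cexp (-(cexp (-(a * I)) * r))) *
    (cexp (a * I) * cexp (-(cexp (a * I) * (z * r ^ q : ℝ))))

open Complex

theorem exp_mul_I_cpow {a : ℝ} (ha : |a| < Real.pi) (s : ℂ) :
    cexp (a * I) ^ s = cexp (a * I * s) := by
  rw [abs_lt] at ha
  rw [cpow_def_of_ne_zero (exp_ne_zero _), log_exp (by simpa using ha.1) (by simpa using ha.2.le)]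

theorem exp_neg_mul_I_cpow_neg {a : ℝ} (ha : |a| < Real.pi) (s : ℂ) :
    cexp (-(a * I)) ^ (-s) = cexp (a * I * s) := by
  have := exp_mul_I_cpow (a := -a) (by rwa [abs_neg]) (-s)
  push_cast at this
  rw [← neg_mul, this]
  ring_nf

theorem re_exp_mul_I (a : ℝ) : (cexp (a * I)).re = Real.cos a := exp_ofReal_mul_I_re a

theorem re_exp_neg_mul_I (a : ℝ) : (cexp (-(a * I))).re = Real.cos a := by
  rw [← neg_mul, ← ofReal_neg, exp_ofReal_mul_I_re, Real.cos_neg]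

variable {q a z : ℝ}

theorem rpow_le_mul_add (hq0 : 0 < q) (hq1 : q < 1) {e : ℝ} (he : 0 < e) :
    ∃ D, ∀ r > 0, r ^ q ≤ e * r + D := by
  -- `R` is where `r^(q-1) = e`: beyond it `r^q ≤ e r`, before it `r^q ≤ R^q`.
  set R : ℝ := e ^ (-(1 - q)⁻¹) with hR
  have hR0 : 0 < R := Real.rpow_pos_of_pos he _
  refine ⟨R ^ q, fun r hr => ?_⟩
  rcases le_total r R with h | h
  · have := Real.rpow_le_rpow hr.le h hq0.le
    nlinarith [mul_pos he hr]
  · have h1 : r ^ (q - 1) ≤ e := by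
      refine (Real.rpow_le_rpow_of_nonpos hR0 h (by linarith)).trans (le_of_eq ?_)
      have hq : 1 - q ≠ 0 := by linarith
      rw [hR, ← Real.rpow_mul he.le, show -(1 - q)⁻¹ * (q - 1) = 1 by field_simp; ring,
        Real.rpow_one]
    have h2 : r ^ q = r ^ (q - 1) * r := by
      rw [← Real.rpow_add_one hr.ne', sub_add_cancel]
    have h3 : 0 < R ^ q := Real.rpow_pos_of_pos hR0 _
    nlinarith [mul_le_mul_of_nonneg_right h1 hr.le]

theorem integrableOn_rpow_mul_exp_mul_exp (hq0 : 0 < q) (hq1 : q < 1) {c : ℝ} (hc : 0 < c)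
    (hz : 0 ≤ z) :
    IntegrableOn (fun r : ℝ => r ^ (q - 1) * Real.exp (-(c * r)) * Real.exp (z * r ^ q))
      (Ioi 0) := by
  -- With this `e`, `z r^q` costs at most half of the decay `c r`; `z + 1` avoids dividing by zero
  -- at `z = 0`.
  obtain ⟨D, hD⟩ := rpow_le_mul_add hq0 hq1 (e := c / (2 * (z + 1))) (by positivity)
  refine ((integrableOn_rpow_sub_one_mul_exp hq0 (half_pos hc)).mul_const
    (Real.exp (z * D))).mono' ?_ ?_
  · refine ContinuousOn.aestronglyMeasurable (fun r hr => ?_) measurableSet_Ioi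
    have hr' : r ≠ 0 := ne_of_gt hr
    have h : ∀ s : ℝ, ContinuousAt (fun x : ℝ => x ^ s) r := fun s =>
      Real.continuousAt_rpow_const _ _ (Or.inl hr')
    exact (((h _).mul (by fun_prop)).mul
      (Real.continuous_exp.continuousAt.comp ((h q).const_mul z))).continuousWithinAt
  · filter_upwards [ae_restrict_mem measurableSet_Ioi] with r hr
    have hr' : 0 < r := hr
    rw [Real.norm_of_nonneg (by positivity), mul_assoc, mul_assoc, ← Real.exp_add, ← Real.exp_add]
    refine mul_le_mul_of_nonneg_left (Real.exp_le_exp.2 ?_) (by positivity)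
    have h1 := mul_le_mul_of_nonneg_left (hD r hr) hz
    have h2 : z * (c / (2 * (z + 1)) * r) ≤ c / 2 * r := by
      have : z * (c / (2 * (z + 1))) ≤ c / 2 := by
        rw [mul_div_assoc', div_le_div_iff₀ (by positivity) (by norm_num)]
        nlinarith
      nlinarith
    linarith

theorem norm_ray_kernel {r : ℝ} (hr : 0 < r) :
    ‖(r : ℂ) ^ ((q : ℂ) - 1) * cexp (-(cexp (-(a * I)) * r))‖ =
      r ^ (q - 1) * Real.exp (-(Real.cos a * r)) := by
  rw [norm_cpow_mul_exp hr, re_exp_neg_mul_I, ofReal_re]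

theorem norm_ray_factor (a u : ℝ) :
    ‖cexp (a * I) * cexp (-(cexp (a * I) * (u : ℂ)))‖ = Real.exp (-(Real.cos a * u)) := by
  rw [norm_mul, norm_exp_ofReal_mul_I, one_mul, norm_exp, neg_re, re_mul_ofReal, re_exp_mul_I]

theorem continuousOn_ray_kernel (q a : ℝ) :
    ContinuousOn (fun r : ℝ => (r : ℂ) ^ ((q : ℂ) - 1) * cexp (-(cexp (-(a * I)) * r)))
      (Ioi 0) :=
  (continuousOn_ofReal_cpow _).mul (by fun_prop)

theorem aestronglyMeasurable_ray (q a z : ℝ) :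
    AEStronglyMeasurable (fun r : ℝ =>
      ((r : ℂ) ^ ((q : ℂ) - 1) * cexp (-(cexp (-(a * I)) * r))) *
        (cexp (a * I) * cexp (-(cexp (a * I) * (z * r ^ q : ℝ))))) (volume.restrict (Ioi 0)) := by
  refine ((continuousOn_ray_kernel q a).mul ?_).aestronglyMeasurable measurableSet_Ioi
  have h : ContinuousOn (fun r : ℝ => z * r ^ q) (Ioi 0) :=
    continuousOn_const.mul (continuousOn_id.rpow_const fun x hx => Or.inl (ne_of_gt hx))
  exact continuousOn_const.mul ((continuous_exp.comp
    (continuous_const.mul continuous_ofReal).neg).comp_continuousOn h)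

/-- Expand the exponential containing `z` and integrate termwise. Term `n` is a Gamma integral with
exponent `q(n+1)` and rate `e^{-ia}`, and the phases combine to `e^{ia(1+q)(n+1)}`. The norms sum to
an integrable function because `r^q` grows more slowly than `r`. -/
theorem hasSum_rayIntegral (hq0 : 0 < q) (hq1 : q < 1) (ha : |a| < Real.pi / 2) (hz : 0 ≤ z) :
    HasSum (fun n : ℕ => (-z : ℂ) ^ n / n.factorial *
      (Complex.Gamma (q * (n + 1)) * cexp (a * I * (1 + q) * (n + 1)))) (rayIntegral q a z) := by
  have hc : 0 < Real.cos a := Real.cos_pos_of_mem_Ioo (abs_lt.1 ha)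
  have haπ : |a| < Real.pi := by linarith [Real.pi_pos]
  have hterm : ∀ n : ℕ, (-z : ℂ) ^ n / n.factorial *
      (Complex.Gamma (q * (n + 1)) * cexp (a * I * (1 + q) * (n + 1))) =
      ∫ r in Ioi (0 : ℝ), ((r : ℂ) ^ ((q : ℂ) - 1) * cexp (-(cexp (-(a * I)) * r))) *
        (cexp (a * I) * ((-(cexp (a * I) * (z * r ^ q : ℝ))) ^ n / n.factorial)) := by
    intro n
    have h := integral_cpow_mul_exp (s := q * (n + 1)) (b := cexp (-(a * I)))
      (by
        have : ((q : ℂ) * (n + 1)).re = q * (n + 1) := by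
          rw [show (q : ℂ) * (n + 1) = ((q * (n + 1) : ℝ) : ℂ) by push_cast; ring, ofReal_re]
        rw [this]
        positivity)
      (by rwa [re_exp_neg_mul_I])
    rw [exp_neg_mul_I_cpow_neg haπ] at h
    have e : ∀ r ∈ Ioi (0 : ℝ),
        ((r : ℂ) ^ ((q : ℂ) - 1) * cexp (-(cexp (-(a * I)) * r))) *
          (cexp (a * I) * ((-(cexp (a * I) * (z * r ^ q : ℝ))) ^ n / n.factorial)) =
        ((-z : ℂ) ^ n / n.factorial * cexp (a * I) ^ (n + 1)) *
          ((r : ℂ) ^ ((q : ℂ) * (n + 1) - 1) * cexp (-(cexp (-(a * I)) * r))) := by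
      intro r hr
      have hr0 : (r : ℂ) ≠ 0 := by exact_mod_cast ne_of_gt hr
      have : (r : ℂ) ^ ((q : ℂ) * (n + 1) - 1) = (r : ℂ) ^ ((q : ℂ) - 1) * ((r ^ q : ℝ) : ℂ) ^ n := by
        rw [ofReal_cpow (le_of_lt hr), ← cpow_mul_nat, ← cpow_add _ _ hr0]
        ring_nf
      rw [this]
      push_cast
      rw [neg_pow, mul_pow, mul_pow, neg_pow (z : ℂ)]
      ring
    rw [setIntegral_congr_fun measurableSet_Ioi e, integral_const_mul, h, ← Complex.exp_nat_mul]
    rw [show (a : ℂ) * I * (1 + q) * (n + 1) = ((n + 1 : ℕ) : ℂ) * (a * I) + a * I * (q * (n + 1)) by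
      push_cast; ring, Complex.exp_add]
    ring
  simp_rw [hterm]
  have hexp : ∀ u : ℝ, HasSum (fun n : ℕ => u ^ n / n.factorial) (Real.exp u) := fun u => by
    rw [Real.exp_eq_exp_ℝ]
    exact NormedSpace.expSeries_div_hasSum_exp u
  have hcexp : ∀ u : ℂ, HasSum (fun n : ℕ => u ^ n / n.factorial) (cexp u) := fun u => by
    rw [Complex.exp_eq_exp_ℂ]
    exact NormedSpace.expSeries_div_hasSum_exp u
  refine hasSum_integral_of_dominated_convergence
    (fun n r => r ^ (q - 1) * Real.exp (-(Real.cos a * r)) * ((z * r ^ q) ^ n / n.factorial))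
    (fun n => ?_) (fun n => ?_) (Filter.Eventually.of_forall fun r => ?_) ?_ ?_
  · refine ((continuousOn_ray_kernel q a).mul ?_).aestronglyMeasurable measurableSet_Ioi
    have h : ContinuousOn (fun r : ℝ => z * r ^ q) (Ioi 0) :=
      continuousOn_const.mul (continuousOn_id.rpow_const fun x hx => Or.inl (ne_of_gt hx))
    exact continuousOn_const.mul ((((continuous_const.mul continuous_ofReal).neg.pow n).div_const
      _).comp_continuousOn h)
  · filter_upwards [ae_restrict_mem measurableSet_Ioi] with r hr
    have hr' : 0 < r := hr
    rw [norm_mul, norm_ray_kernel hr, norm_mul, norm_exp_ofReal_mul_I, one_mul, norm_div, norm_pow,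
      norm_neg, norm_mul, norm_exp_ofReal_mul_I, one_mul, norm_real,
      Real.norm_of_nonneg (by positivity), RCLike.norm_natCast]
  · exact (hexp _).summable.mul_left _
  · refine (integrableOn_rpow_mul_exp_mul_exp hq0 hq1 hc hz).congr
      (Filter.Eventually.of_forall fun r => ?_)
    exact ((hexp (z * r ^ q)).mul_left _).tsum_eq.symm
  · exact Filter.Eventually.of_forall fun r => ((hcexp _).mul_left _).mul_left _

theorem continuousOn_rayIntegral (hq0 : 0 < q) (ha : |a| < Real.pi / 2) :
    ContinuousOn (rayIntegral q a) (Ici 0) := by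
  have hc : 0 < Real.cos a := Real.cos_pos_of_mem_Ioo (abs_lt.1 ha)
  refine continuousOn_of_dominated
    (bound := fun r => r ^ (q - 1) * Real.exp (-(Real.cos a * r)))
    (fun z _ => aestronglyMeasurable_ray q a z) (fun z hz => ?_)
    (integrableOn_rpow_sub_one_mul_exp hq0 hc) (Filter.Eventually.of_forall fun r => ?_)
  · filter_upwards [ae_restrict_mem measurableSet_Ioi] with r hr
    have hr' : 0 < r := hr
    have hz' : 0 ≤ z := hz
    rw [norm_mul, norm_ray_kernel hr, norm_ray_factor]
    refine mul_le_of_le_one_right (by positivity) ?_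
    rw [Real.exp_le_one_iff, neg_nonpos]
    positivity
  · fun_prop

/-- Discard the decay in `r` and keep the one in `z r^q`: `∫ r^(q-1) e^{-c z r^q} dr = 1 / (q c z)`
with `c = cos a`. -/
theorem norm_rayIntegral_le (hq0 : 0 < q) (ha : |a| < Real.pi / 2) (hz : 0 < z) :
    ‖rayIntegral q a z‖ ≤ (q * Real.cos a)⁻¹ / z := by
  have hc : 0 < Real.cos a := Real.cos_pos_of_mem_Ioo (abs_lt.1 ha)
  have hcz : 0 < Real.cos a * z := mul_pos hc hz
  have hval := integral_rpow_mul_exp_neg_mul_rpow (p := q) (q := q - 1) (b := Real.cos a * z)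
    hq0 (by linarith) hcz
  have hint := integrableOn_rpow_mul_exp_neg_mul_rpow (p := q) (s := q - 1) (b := Real.cos a * z)
    (by linarith) hq0 hcz
  refine (norm_integral_le_of_norm_le hint ?_).trans (le_of_eq ?_)
  · filter_upwards [ae_restrict_mem measurableSet_Ioi] with r hr
    have hr' : 0 < r := hr
    rw [norm_mul, norm_ray_kernel hr, norm_ray_factor, mul_assoc]
    refine mul_le_mul_of_nonneg_left ?_ (by positivity)
    rw [show -(Real.cos a * z) * r ^ q = -(Real.cos a * (z * r ^ q)) by ring]
    refine mul_le_of_le_one_left (Real.exp_pos _).le ?_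
    rw [Real.exp_le_one_iff, neg_nonpos]
    positivity
  · rw [hval, sub_add_cancel, neg_div, div_self hq0.ne', Real.Gamma_one, Real.rpow_neg_one]
    field_simp

/-- The ray integral superposes dilates of `e^{ia} e^{-e^{ia} u}`. The strip is where both resulting
Gamma integrals converge, with exponents `δ` and `q(1-δ)`. -/
theorem hasMellin_rayIntegral (hq0 : 0 < q) (ha : |a| < Real.pi / 2) {δ : ℂ} (h0 : 0 < δ.re)
    (h1 : δ.re < 1) :
    HasMellin (rayIntegral q a) δ (Complex.Gamma δ * Complex.Gamma (q * (1 - δ)) *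
      cexp (a * I * (1 + q) * (1 - δ))) := by
  have hc : 0 < Real.cos a := Real.cos_pos_of_mem_Ioo (abs_lt.1 ha)
  have haπ : |a| < Real.pi := by linarith [Real.pi_pos]
  have hre : 0 < ((q : ℂ) * (1 - δ)).re := by
    rw [re_ofReal_mul]
    exact mul_pos hq0 (by simpa using h1)
  have hG := integral_cpow_mul_exp (s := δ) (b := cexp (a * I)) h0 (by rwa [re_exp_mul_I])
  have hGi := integrableOn_cpow_mul_exp (s := δ) (b := cexp (a * I)) h0 (by rwa [re_exp_mul_I])
  have hK := integral_cpow_mul_exp (s := q * (1 - δ)) (b := cexp (-(a * I))) hre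
    (by rwa [re_exp_neg_mul_I])
  have hKi := integrableOn_cpow_mul_exp (s := q * (1 - δ)) (b := cexp (-(a * I))) hre
    (by rwa [re_exp_neg_mul_I])
  have e : ∀ r ∈ Ioi (0 : ℝ), (r : ℂ) ^ ((q : ℂ) * (1 - δ) - 1) * cexp (-(cexp (-(a * I)) * r)) =
      ((r : ℂ) ^ ((q : ℂ) - 1) * cexp (-(cexp (-(a * I)) * r))) * (r : ℂ) ^ (-(q * δ)) := by
    intro r hr
    have hr0 : (r : ℂ) ≠ 0 := by exact_mod_cast ne_of_gt hr
    rw [show (q : ℂ) * (1 - δ) - 1 = (q - 1) + -(q * δ) by ring, cpow_add _ _ hr0]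
    ring
  have e2 : (fun t : ℝ => (t : ℂ) ^ (δ - 1) • (cexp (a * I) * cexp (-(cexp (a * I) * t)))) =
      fun t : ℝ => cexp (a * I) * ((t : ℂ) ^ (δ - 1) * cexp (-(cexp (a * I) * t))) := by
    ext t
    rw [smul_eq_mul]
    ring
  have key := hasMellin_integral_comp_mul (p := q) (δ := δ) (continuousOn_ray_kernel q a)
    (g := fun u : ℝ => cexp (a * I) * cexp (-(cexp (a * I) * u))) (by fun_prop)
    (by rw [MellinConvergent, e2]; exact hGi.const_mul _) (hKi.congr_fun e measurableSet_Ioi)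
  rw [← setIntegral_congr_fun measurableSet_Ioi e, hK, mellin, e2, integral_const_mul, hG,
    exp_neg_mul_I_cpow_neg haπ, exp_mul_I_cpow haπ] at key
  convert! key using 1
  rw [show (a : ℂ) * I * (1 + q) * (1 - δ) = a * I + a * I * -δ + a * I * (q * (1 - δ)) by ring,
    Complex.exp_add, Complex.exp_add]
  ring

end Ray

/-! ### Continuity, decay and Mellin transform of Mainardi's function -/

section Mainardi

open Complex

variable {q z : ℝ}

/-- The angle `a` for which `a (1 + q) = π q`. -/
noncomputable def rayAngle (q : ℝ) : ℝ := Real.pi * q / (1 + q)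

/-- `q < 1` gives `q / (1 + q) < 1/2`, so the cosine of the angle is positive and both exponentials
in the ray integral decay. -/
theorem abs_rayAngle_lt (hq0 : 0 < q) (hq1 : q < 1) : |rayAngle q| < Real.pi / 2 := by
  have := Real.pi_pos
  rw [rayAngle, abs_of_pos (by positivity), div_lt_div_iff₀ (by positivity) (by norm_num)]
  nlinarith

theorem abs_neg_rayAngle_lt (hq0 : 0 < q) (hq1 : q < 1) : |-rayAngle q| < Real.pi / 2 := by
  rw [abs_neg]
  exact abs_rayAngle_lt hq0 hq1

theorem rayAngle_mul (hq0 : 0 < q) : (rayAngle q : ℂ) * I * (1 + q) = Real.pi * q * I := by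
  have h : rayAngle q * (1 + q) = Real.pi * q := by
    rw [rayAngle, div_mul_cancel₀]
    positivity
  rw [mul_right_comm, show (rayAngle q : ℂ) * (1 + q) = ((rayAngle q * (1 + q) : ℝ) : ℂ) by
    push_cast; ring, h]
  push_cast
  ring

theorem neg_rayAngle_mul (hq0 : 0 < q) :
    ((-rayAngle q : ℝ) : ℂ) * I * (1 + q) = -(Real.pi * q * I) := by
  rw [← rayAngle_mul hq0]
  push_cast
  ring

theorem inv_Gamma_one_sub {y : ℝ} (hy : 0 < y) :
    (Real.Gamma (1 - y))⁻¹ = Real.Gamma y * Real.sin (Real.pi * y) / Real.pi := by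
  have h := Real.Gamma_mul_Gamma_one_sub y
  have hG := (Real.Gamma_pos_of_pos hy).ne'
  -- If the sine vanishes, the reflection formula reads `Γ(y) Γ(1-y) = π / 0 = 0`, so `Γ(1-y) = 0`,
  -- in agreement with the convention at the poles.
  by_cases hs : Real.sin (Real.pi * y) = 0
  · rw [hs, div_zero] at h
    rw [(mul_eq_zero.1 h).resolve_left hG, hs]
    simp
  · have h2 : Real.Gamma (1 - y) = Real.pi / Real.sin (Real.pi * y) / Real.Gamma y := by
      rw [← h, mul_div_cancel_left₀ _ hG]
    rw [h2, div_div, inv_div, mul_comm (Real.sin _)]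

theorem exp_sub_exp_neg_div (u : ℂ) :
    (cexp (u * I) - cexp (-(u * I))) / (2 * Real.pi * I) = Complex.sin u / Real.pi := by
  have hπ : (Real.pi : ℂ) ≠ 0 := by exact_mod_cast Real.pi_ne_zero
  have h : Complex.sin u = (cexp (-u * I) - cexp (u * I)) * I / 2 := rfl
  rw [h, neg_mul]
  field_simp
  rw [I_sq]
  ring

/-- Mainardi's series sums to the difference of the integrals over two conjugate rays. -/
theorem hasSum_mainardiTerm (hq0 : 0 < q) (hq1 : q < 1) (hz : 0 ≤ z) :
    HasSum (fun n => (mainardiTerm q z n : ℂ))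
      ((rayIntegral q (rayAngle q) z - rayIntegral q (-rayAngle q) z) / (2 * Real.pi * I)) := by
  have h1 := hasSum_rayIntegral hq0 hq1 (abs_rayAngle_lt hq0 hq1) hz
  have h2 := hasSum_rayIntegral hq0 hq1 (abs_neg_rayAngle_lt hq0 hq1) hz
  refine ((h1.sub h2).div_const (2 * Real.pi * I)).congr_fun fun n => ?_
  rw [rayAngle_mul hq0, neg_rayAngle_mul hq0, ← mul_sub, ← mul_sub, mul_div_assoc, mul_div_assoc,
    show (Real.pi : ℂ) * q * I * (n + 1) = ((Real.pi * (q * (n + 1)) : ℝ) : ℂ) * I by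
      push_cast; ring,
    show -((Real.pi : ℂ) * q * I) * (n + 1) = -(((Real.pi * (q * (n + 1)) : ℝ) : ℂ) * I) by
      push_cast; ring, exp_sub_exp_neg_div, mainardiTerm, ← div_div,
    div_eq_mul_inv _ (Real.Gamma _), inv_Gamma_one_sub (by positivity)]
  push_cast [← Complex.Gamma_ofReal]
  ring

theorem mainardiTerm_one (z : ℝ) (n : ℕ) : mainardiTerm 1 z n = 0 := by
  have : Real.Gamma (1 - 1 * ((n : ℝ) + 1)) = 0 := by
    rw [show 1 - 1 * ((n : ℝ) + 1) = -n by ring, Real.Gamma_neg_nat_eq_zero]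
  rw [mainardiTerm, this, mul_zero, div_zero]

theorem mainardi_one (z : ℝ) : mainardi 1 z = 0 := by
  simp_rw [mainardi, mainardiTerm_one, tsum_zero]

theorem summable_mainardiTerm (hq0 : 0 < q) (hq1 : q ≤ 1) (hz : 0 ≤ z) :
    Summable (mainardiTerm q z) := by
  rcases hq1.eq_or_lt with rfl | hq1
  · exact summable_zero.congr fun n => (mainardiTerm_one z n).symm
  · exact Complex.summable_ofReal.1 (hasSum_mainardiTerm hq0 hq1 hz).summable

theorem ofReal_mainardi (hq0 : 0 < q) (hq1 : q < 1) (hz : 0 ≤ z) :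
    (mainardi q z : ℂ) =
      (rayIntegral q (rayAngle q) z - rayIntegral q (-rayAngle q) z) / (2 * Real.pi * I) := by
  rw [mainardi, Complex.ofReal_tsum]
  exact (hasSum_mainardiTerm hq0 hq1 hz).tsum_eq

theorem continuousOn_mainardi (hq0 : 0 < q) (hq1 : q < 1) : ContinuousOn (mainardi q) (Ici 0) := by
  have h := (((continuousOn_rayIntegral hq0 (abs_rayAngle_lt hq0 hq1)).sub
    (continuousOn_rayIntegral hq0 (abs_neg_rayAngle_lt hq0 hq1))).div_const (2 * Real.pi * I))
  refine (continuous_re.comp_continuousOn h).congr fun z hz => ?_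
  rw [Function.comp_apply, Pi.sub_apply, ← ofReal_mainardi hq0 hq1 hz, ofReal_re]

theorem exists_abs_mainardi_le (hq0 : 0 < q) (hq1 : q < 1) :
    ∃ B, ∀ z > 0, |mainardi q z| ≤ B / z := by
  refine ⟨((q * Real.cos (rayAngle q))⁻¹ + (q * Real.cos (-rayAngle q))⁻¹) / (2 * Real.pi),
    fun z hz => ?_⟩
  have h1 := norm_rayIntegral_le hq0 (abs_rayAngle_lt hq0 hq1) hz
  have h2 := norm_rayIntegral_le hq0 (abs_neg_rayAngle_lt hq0 hq1) hz
  rw [← Real.norm_eq_abs, ← Complex.norm_real, ofReal_mainardi hq0 hq1 hz.le, norm_div]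
  have h3 : ‖(2 * Real.pi * I : ℂ)‖ = 2 * Real.pi := by
    simp [abs_of_pos Real.pi_pos]
  rw [h3, div_right_comm, add_div]
  exact div_le_div_of_nonneg_right ((norm_sub_le _ _).trans (add_le_add h1 h2))
    (by positivity)

theorem hasMellin_mainardi (hq0 : 0 < q) (hq1 : q < 1) {δ : ℂ} (h0 : 0 < δ.re) (h1 : δ.re < 1) :
    HasMellin (fun z => (mainardi q z : ℂ)) δ (Complex.Gamma δ * Complex.Gamma (q * (1 - δ)) *
      (Complex.sin (Real.pi * (q * (1 - δ))) / Real.pi)) := by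
  have m1 := hasMellin_rayIntegral hq0 (abs_rayAngle_lt hq0 hq1) h0 h1
  have m2 := hasMellin_rayIntegral hq0 (abs_neg_rayAngle_lt hq0 hq1) h0 h1
  have m3 := hasMellin_sub m1.1 m2.1
  have e : ∀ z ∈ Ioi (0 : ℝ), (z : ℂ) ^ (δ - 1) • ((rayIntegral q (rayAngle q) z -
      rayIntegral q (-rayAngle q) z) / (2 * Real.pi * I)) =
      (z : ℂ) ^ (δ - 1) • (mainardi q z : ℂ) := fun z hz => by
    rw [ofReal_mainardi hq0 hq1 (le_of_lt hz)]
  refine ⟨(m3.1.div_const (2 * Real.pi * I)).congr_fun e measurableSet_Ioi, ?_⟩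
  rw [mellin, ← setIntegral_congr_fun measurableSet_Ioi e]
  change mellin (fun z => (rayIntegral q (rayAngle q) z -
      rayIntegral q (-rayAngle q) z) / (2 * Real.pi * I)) δ = _
  rw [mellin_div_const, m3.2, m1.2, m2.2, rayAngle_mul hq0, neg_rayAngle_mul hq0, ← mul_sub,
    mul_div_assoc,
    show (Real.pi : ℂ) * q * I * (1 - δ) = (Real.pi * (q * (1 - δ))) * I by ring,
    show -((Real.pi : ℂ) * q * I) * (1 - δ) = -((Real.pi * (q * (1 - δ))) * I) by ring,
    exp_sub_exp_neg_div]

/-- The reflection formula used backwards at `y = q(1-δ)`; `0 < Re y < 1` keeps both Gamma values,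
and hence the sine, nonzero. -/
theorem mellin_mainardi_mul_Gamma (hq0 : 0 < q) (hq1 : q < 1) {δ : ℂ} (h0 : 0 < δ.re)
    (h1 : δ.re < 1) :
    mellin (fun z => (mainardi q z : ℂ)) δ * Complex.Gamma (1 - q * (1 - δ)) =
      Complex.Gamma δ := by
  have hre : ((q : ℂ) * (1 - δ)).re = q * (1 - δ.re) := by simp
  have hy0 : 0 < ((q : ℂ) * (1 - δ)).re := by
    rw [hre]
    exact mul_pos hq0 (by linarith)
  have hy1 : 0 < (1 - (q : ℂ) * (1 - δ)).re := by
    rw [sub_re, hre, one_re]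
    nlinarith
  rw [(hasMellin_mainardi hq0 hq1 h0 h1).2]
  generalize (q : ℂ) * (1 - δ) = y at hy0 hy1
  have hr := Complex.Gamma_mul_Gamma_one_sub y
  have hne : Complex.Gamma y * Complex.Gamma (1 - y) ≠ 0 :=
    mul_ne_zero (Gamma_ne_zero_of_re_pos hy0) (Gamma_ne_zero_of_re_pos hy1)
  have hsin : Complex.sin (Real.pi * y) ≠ 0 := by
    intro h
    rw [h, div_zero] at hr
    exact hne hr
  have hπ : (Real.pi : ℂ) ≠ 0 := by exact_mod_cast Real.pi_ne_zero
  calc _ = Complex.Gamma δ * (Complex.Gamma y * Complex.Gamma (1 - y)) *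
        (Complex.sin (Real.pi * y) / Real.pi) := by ring
    _ = _ := by
      rw [hr]
      field_simp

end Mainardi

/-! ### Laplace transform and positivity of Mainardi's function -/

section Laplace

open Complex

/-- The difference has zero Mellin transform on the line, which is trivially integrable there, so
Mellin inversion applies at a continuity point. -/
theorem eq_of_mellin_eq_on_line {f g : ℝ → ℂ} {σ : ℝ}
    (hf : ∀ δ : ℂ, δ.re = σ → MellinConvergent f δ) (hg : ∀ δ : ℂ, δ.re = σ → MellinConvergent g δ)
    (hfg : ∀ δ : ℂ, δ.re = σ → mellin f δ = mellin g δ) {x : ℝ} (hx : 0 < x)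
    (hfx : ContinuousAt f x) (hgx : ContinuousAt g x) : f x = g x := by
  have hzero : ∀ y : ℝ, mellin (fun t => f t - g t) (σ + y * I) = 0 := fun y => by
    have hre : ((σ : ℂ) + y * I).re = σ := by simp
    rw [(hasMellin_sub (hf _ hre) (hg _ hre)).2, hfg _ hre, sub_self]
  have hconv := (hasMellin_sub (hf σ (ofReal_re σ)) (hg σ (ofReal_re σ))).1
  have hv : VerticalIntegrable (mellin (fun t => f t - g t)) σ := by
    rw [VerticalIntegrable]
    simp_rw [hzero]
    exact integrable_zero _ _ _
  have h := mellinInv_mellin_eq σ _ hx hconv hv (hfx.sub hgx)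
  rw [mellinInv] at h
  simp_rw [hzero, smul_zero, integral_zero, smul_zero] at h
  exact sub_eq_zero.1 h.symm

variable {q l x : ℝ}

/-- The decay `B / z` exactly absorbs `t^(-q)`, leaving the bound uniform in `t` that Post–Widder
requires. -/
theorem abs_rpow_mul_mainardi_le {B t : ℝ} (hB : ∀ z > 0, |mainardi q z| ≤ B / z) (hx : 0 < x)
    (ht : 0 < t) : |t ^ (-q) * mainardi q (x * t ^ (-q))| ≤ B / x := by
  have htq : 0 < t ^ (-q) := Real.rpow_pos_of_pos ht _
  rw [abs_mul, abs_of_pos htq]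
  refine (mul_le_mul_of_nonneg_left (hB _ (mul_pos hx htq)) htq.le).trans (le_of_eq ?_)
  field_simp

theorem continuousOn_mainardi_comp (hq0 : 0 < q) (hq1 : q < 1) (hx : 0 ≤ x) :
    ContinuousOn (fun t : ℝ => mainardi q (x * t ^ (-q))) (Ioi 0) :=
  (continuousOn_mainardi hq0 hq1).comp (continuousOn_const.mul
    (continuousOn_id.rpow_const fun _ ht => Or.inl (ne_of_gt ht)))
    fun _ ht => mul_nonneg hx (Real.rpow_nonneg (le_of_lt ht) _)

theorem continuousOn_rpow_mul_mainardi (hq0 : 0 < q) (hq1 : q < 1) (hx : 0 ≤ x) :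
    ContinuousOn (fun t : ℝ => t ^ (-q) * mainardi q (x * t ^ (-q))) (Ioi 0) :=
  (continuousOn_id.rpow_const fun _ ht => Or.inl (ne_of_gt ht)).mul
    (continuousOn_mainardi_comp hq0 hq1 hx)

theorem continuousAt_laplace_mainardi (hq0 : 0 < q) (hq1 : q < 1) (hl : 0 < l) (hx : 0 < x) :
    ContinuousAt (fun x : ℝ => ∫ t in Ioi (0 : ℝ),
      Real.exp (-(l * t)) * (t ^ (-q) * mainardi q (x * t ^ (-q)))) x := by
  obtain ⟨B, hB⟩ := exists_abs_mainardi_le hq0 hq1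
  have hx2 : 0 < x / 2 := half_pos hx
  refine ContinuousOn.continuousAt (s := Ioi (x / 2)) ?_ (Ioi_mem_nhds (by linarith))
  refine continuousOn_of_dominated (bound := fun t => Real.exp (-l * t) * (B / (x / 2)))
    (fun y hy => ?_) (fun y hy => ?_) ((exp_neg_integrableOn_Ioi 0 hl).mul_const _) ?_
  · have hy' : 0 ≤ y := (hx2.trans hy).le
    exact ((Continuous.continuousOn (by fun_prop)).mul
      (continuousOn_rpow_mul_mainardi hq0 hq1 hy')).aestronglyMeasurable measurableSet_Ioi
  · filter_upwards [ae_restrict_mem measurableSet_Ioi] with t ht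
    have hB0 : 0 ≤ B := by
      have := (abs_nonneg _).trans (hB 1 one_pos)
      simpa using this
    rw [Real.norm_eq_abs, abs_mul, abs_of_pos (Real.exp_pos _), neg_mul]
    refine mul_le_mul_of_nonneg_left ?_ (Real.exp_pos _).le
    exact (abs_rpow_mul_mainardi_le hB (hx2.trans hy) ht).trans
      (div_le_div_of_nonneg_left hB0 hx2 (le_of_lt hy))
  · filter_upwards [ae_restrict_mem measurableSet_Ioi] with t ht
    have ht' : 0 ≤ t := le_of_lt ht
    refine continuousOn_const.mul (continuousOn_const.mul
      ((continuousOn_mainardi hq0 hq1).comp (by fun_prop) fun y hy => ?_))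
    exact mul_nonneg (hx2.trans hy).le (Real.rpow_nonneg ht' _)

/-- Superposition of dilates with kernel `r^(-q) e^{-lr}` and power `-q`: the kernel contributes
`Γ(1 - q(1-δ))`, which cancels the denominator in the Mellin transform of `M_q`. -/
theorem hasMellin_laplace_mainardi (hq0 : 0 < q) (hq1 : q < 1) (hl : 0 < l) {δ : ℂ}
    (h0 : 0 < δ.re) (h1 : δ.re < 1) :
    HasMellin (fun x : ℝ => ((∫ t in Ioi (0 : ℝ),
      Real.exp (-(l * t)) * (t ^ (-q) * mainardi q (x * t ^ (-q))) : ℝ) : ℂ)) δ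
      ((l : ℂ) ^ (-(1 - q * (1 - δ))) * Complex.Gamma δ) := by
  have hre : 0 < (1 - (q : ℂ) * (1 - δ)).re := by
    have : ((q : ℂ) * (1 - δ)).re = q * (1 - δ.re) := by simp
    rw [sub_re, this, one_re]
    nlinarith
  have hG := integral_cpow_mul_exp (b := (l : ℂ)) hre (by simpa using hl)
  have hGi := integrableOn_cpow_mul_exp (b := (l : ℂ)) hre (by simpa using hl)
  have e : ∀ r ∈ Ioi (0 : ℝ), (r : ℂ) ^ (1 - (q : ℂ) * (1 - δ) - 1) * cexp (-(l * r)) =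
      ((r : ℂ) ^ (-(q : ℂ)) * cexp (-(l * r))) * (r : ℂ) ^ (-(((-q : ℝ) : ℂ) * δ)) := by
    intro r hr
    have hr0 : (r : ℂ) ≠ 0 := by exact_mod_cast ne_of_gt hr
    rw [show 1 - (q : ℂ) * (1 - δ) - 1 = -(q : ℂ) + -(((-q : ℝ) : ℂ) * δ) by push_cast; ring,
      cpow_add _ _ hr0]
    ring
  have key := hasMellin_integral_comp_mul (p := -q) (δ := δ)
    (k := fun r : ℝ => (r : ℂ) ^ (-(q : ℂ)) * cexp (-(l * r)))
    (g := fun z => (mainardi q z : ℂ))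
    ((continuousOn_ofReal_cpow _).mul (by fun_prop))
    (continuous_ofReal.comp_continuousOn ((continuousOn_mainardi hq0 hq1).mono Ioi_subset_Ici_self))
    (hasMellin_mainardi hq0 hq1 h0 h1).1 (hGi.congr_fun e measurableSet_Ioi)
  rw [← setIntegral_congr_fun measurableSet_Ioi e, hG, mul_left_comm,
    mellin_mainardi_mul_Gamma hq0 hq1 h0 h1] at key
  convert! key using 2 with x
  rw [← integral_complex_ofReal]
  refine setIntegral_congr_fun measurableSet_Ioi fun t ht => ?_
  push_cast [Complex.ofReal_cpow (le_of_lt ht)]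
  ring

theorem hasMellin_const_mul_exp (hl : 0 < l) {δ : ℂ} (h0 : 0 < δ.re) :
    HasMellin (fun x : ℝ => ((l ^ (q - 1) * Real.exp (-(x * l ^ q)) : ℝ) : ℂ)) δ
      ((l : ℂ) ^ (-(1 - q * (1 - δ))) * Complex.Gamma δ) := by
  have hlq : 0 < l ^ q := Real.rpow_pos_of_pos hl q
  have hl0 : (l : ℂ) ≠ 0 := by exact_mod_cast hl.ne'
  have hG := integral_cpow_mul_exp (b := ((l ^ q : ℝ) : ℂ)) h0 (by simpa using hlq)
  have hGi := integrableOn_cpow_mul_exp (b := ((l ^ q : ℝ) : ℂ)) h0 (by simpa using hlq)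
  have e : (fun x : ℝ => (x : ℂ) ^ (δ - 1) •
      ((l ^ (q - 1) * Real.exp (-(x * l ^ q)) : ℝ) : ℂ)) = fun x : ℝ =>
      ((l ^ (q - 1) : ℝ) : ℂ) * ((x : ℂ) ^ (δ - 1) * cexp (-(((l ^ q : ℝ) : ℂ) * x))) := by
    ext x
    push_cast
    rw [smul_eq_mul, mul_comm (x : ℂ) (((l ^ q : ℝ) : ℂ))]
    ring
  constructor
  · rw [MellinConvergent, e]
    exact hGi.const_mul _
  · have hpow : ((l ^ (q - 1) : ℝ) : ℂ) * ((l ^ q : ℝ) : ℂ) ^ (-δ) =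
        (l : ℂ) ^ (-(1 - q * (1 - δ))) := by
      rw [cpow_def_of_ne_zero (by exact_mod_cast hlq.ne'), cpow_def_of_ne_zero hl0,
        Real.rpow_def_of_pos hl (q - 1), ← ofReal_log hlq.le, Real.log_rpow hl, ← ofReal_log hl.le,
        ofReal_exp, ← Complex.exp_add]
      push_cast
      ring_nf
    rw [mellin, e, integral_const_mul, hG, ← mul_assoc, hpow]

theorem laplace_mainardi (hq0 : 0 < q) (hq1 : q < 1) (hl : 0 < l) (hx : 0 < x) :
    ∫ t in Ioi (0 : ℝ), Real.exp (-(l * t)) * (t ^ (-q) * mainardi q (x * t ^ (-q))) =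
      l ^ (q - 1) * Real.exp (-(x * l ^ q)) := by
  have hre : ∀ δ : ℂ, δ.re = (1 / 2 : ℝ) → 0 < δ.re ∧ δ.re < 1 := fun δ h => by
    rw [h]
    norm_num
  have h := eq_of_mellin_eq_on_line (σ := 1 / 2)
    (fun δ h => (hasMellin_laplace_mainardi hq0 hq1 hl (hre δ h).1 (hre δ h).2).1)
    (fun δ h => (hasMellin_const_mul_exp (q := q) hl (hre δ h).1).1)
    (fun δ h => (hasMellin_laplace_mainardi hq0 hq1 hl (hre δ h).1 (hre δ h).2).2.trans
      (hasMellin_const_mul_exp hl (hre δ h).1).2.symm) hx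
    (continuous_ofReal.continuousAt.comp (continuousAt_laplace_mainardi hq0 hq1 hl hx))
    (by fun_prop)
  exact ofReal_injective h

theorem mainardi_nonneg (hq0 : 0 < q) (hq1 : q < 1) (hx : 0 ≤ x) : 0 ≤ mainardi q x := by
  have hpos : ∀ x > 0, 0 ≤ mainardi q x := by
    intro x hx
    obtain ⟨B, hB⟩ := exists_abs_mainardi_le hq0 hq1
    have hf := continuousOn_rpow_mul_mainardi hq0 hq1 hx.le
    have hb : ∀ t > 0, |t ^ (-q) * mainardi q (x * t ^ (-q))| ≤ B / x := fun t ht =>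
      abs_rpow_mul_mainardi_le hB hx ht
    have h := nonneg_at_one_of_laplace_moment_nonneg hf hb fun n => by
      have hcm : IsCompletelyMonotoneUpTo n (fun l : ℝ => ∫ t in Ioi (0 : ℝ),
          t ^ 0 * Real.exp (-(l * t)) * (t ^ (-q) * mainardi q (x * t ^ (-q)))) :=
        ((IsCompletelyMonotoneUpTo.rpow (a := q - 1) (by linarith) n).mul
          (IsCompletelyMonotoneUpTo.exp_neg_mul_rpow hq0.le hq1.le hx.le n)).congr fun l hl => by
            simp_rw [pow_zero, one_mul]
            exact (laplace_mainardi hq0 hq1 hl hx).symm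
      simpa using laplace_moment_nonneg hf hb hcm (l := n + 1) (by positivity)
    simpa using h
  -- The bound `B / x` is useless at `x = 0`; that case follows by continuity from the right.
  rcases hx.eq_or_lt with rfl | hx
  · have hc : ContinuousWithinAt (mainardi q) (Ioi 0) 0 :=
      ((continuousOn_mainardi hq0 hq1) 0 self_mem_Ici).mono Ioi_subset_Ici_self
    refine ge_of_tendsto hc ?_
    filter_upwards [self_mem_nhdsWithin] with y hy using hpos y hy
  · exact hpos x hx

end Laplace

/-! ### Moments of Mainardi's function -/

section Moments

variable {q : ℝ}

theorem lintegral_Ioi_mul_comp_mul_left {a : ℝ} (ha : 0 < a) (G : ℝ → ENNReal) :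
    ∫⁻ x in Ioi (0 : ℝ), ENNReal.ofReal a * G (a * x) = ∫⁻ y in Ioi (0 : ℝ), G y := by
  have himg : (fun x : ℝ => a * x) '' Ioi 0 = Ioi 0 := by
    simpa using image_mul_left_Ioi ha 0
  have h := lintegral_image_eq_lintegral_abs_deriv_mul (s := Ioi (0 : ℝ)) (f := fun x => a * x)
    (f' := fun _ => a) measurableSet_Ioi
    (fun x _ => by simpa using ((hasDerivAt_id x).const_mul a).hasDerivWithinAt)
    ((mul_right_injective₀ ha.ne').injOn) G
  rw [himg, abs_of_pos ha] at h
  exact h.symm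

/-- Integrate `x^m` against the Laplace identity at `l = 1` in both orders: one gives `m!`, the
other, after scaling `x` by `t^(-q)`, gives `Γ(qm + 1)` times the moment. Extended nonnegative
integrals make finiteness a conclusion. -/
theorem lintegral_pow_mul_mainardi (hq0 : 0 < q) (hq1 : q < 1) (m : ℕ) :
    ENNReal.ofReal (Real.Gamma (q * m + 1)) *
      ∫⁻ y in Ioi (0 : ℝ), ENNReal.ofReal (y ^ m * mainardi q y) =
      ENNReal.ofReal m.factorial := by
  have hGamma : ∀ s : ℝ, 0 < s → ∫⁻ t in Ioi (0 : ℝ),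
      ENNReal.ofReal (t ^ (s - 1) * Real.exp (-t)) = ENNReal.ofReal (Real.Gamma s) := by
    intro s hs
    have hi := integrableOn_rpow_sub_one_mul_exp hs one_pos
    have hv := Real.integral_rpow_mul_exp_neg_mul_Ioi hs one_pos
    simp only [one_mul, div_one, Real.one_rpow] at hi hv
    rw [← hv, ofReal_integral_eq_lintegral_ofReal hi]
    filter_upwards [ae_restrict_mem measurableSet_Ioi] with t ht
    have : 0 < t := ht
    simp only [Pi.zero_apply]
    positivity
  have hmeas : AEMeasurable (Function.uncurry fun x t : ℝ =>
      ENNReal.ofReal (x ^ m * (Real.exp (-(1 * t)) * (t ^ (-q) * mainardi q (x * t ^ (-q))))))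
      ((volume.restrict (Ioi (0 : ℝ))).prod (volume.restrict (Ioi (0 : ℝ)))) := by
    rw [Measure.prod_restrict]
    refine AEMeasurable.ennreal_ofReal (ContinuousOn.aemeasurable ?_
      (measurableSet_Ioi.prod measurableSet_Ioi))
    have hp : ContinuousOn (fun x : ℝ × ℝ => x.2 ^ (-q)) (Ioi 0 ×ˢ Ioi 0) :=
      continuousOn_snd.rpow_const fun x hx => Or.inl (ne_of_gt hx.2)
    refine (continuousOn_fst.pow m).mul (ContinuousOn.mul (by fun_prop) (hp.mul
      ((continuousOn_mainardi hq0 hq1).comp (continuousOn_fst.mul hp) fun x hx => ?_)))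
    exact mul_nonneg (le_of_lt hx.1) (Real.rpow_nonneg (le_of_lt hx.2) _)
  have hswap := lintegral_lintegral_swap hmeas
  have hleft : ∀ x ∈ Ioi (0 : ℝ), ∫⁻ t in Ioi (0 : ℝ),
      ENNReal.ofReal (x ^ m * (Real.exp (-(1 * t)) * (t ^ (-q) * mainardi q (x * t ^ (-q))))) =
      ENNReal.ofReal (x ^ ((m + 1 : ℝ) - 1) * Real.exp (-x)) := by
    intro x hx
    have hx' : 0 < x := hx
    have h := laplace_mainardi hq0 hq1 one_pos hx
    rw [Real.one_rpow, Real.one_rpow, one_mul, mul_one] at h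
    -- A Bochner integral of a non-integrable function is `0`, whereas this one equals `e^{-x}`.
    have hi : IntegrableOn (fun t : ℝ =>
        Real.exp (-(1 * t)) * (t ^ (-q) * mainardi q (x * t ^ (-q)))) (Ioi 0) :=
      Integrable.of_integral_ne_zero (by rw [h]; exact (Real.exp_pos _).ne')
    rw [← ofReal_integral_eq_lintegral_ofReal (hi.const_mul _), integral_const_mul, h]
    · simp
    · filter_upwards [ae_restrict_mem measurableSet_Ioi] with t ht
      have ht' : 0 < t := ht
      have := mainardi_nonneg (x := x * t ^ (-q)) hq0 hq1 (by positivity)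
      simp only [Pi.zero_apply]
      positivity
  have hright : ∀ t ∈ Ioi (0 : ℝ), ∫⁻ x in Ioi (0 : ℝ),
      ENNReal.ofReal (x ^ m * (Real.exp (-(1 * t)) * (t ^ (-q) * mainardi q (x * t ^ (-q))))) =
      ENNReal.ofReal (t ^ ((q * m + 1) - 1) * Real.exp (-t)) *
        ∫⁻ y in Ioi (0 : ℝ), ENNReal.ofReal (y ^ m * mainardi q y) := by
    intro t ht
    have ht' : 0 < t := ht
    have ha : 0 < t ^ (-q) := Real.rpow_pos_of_pos ht' _
    rw [← lintegral_Ioi_mul_comp_mul_left ha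
      (fun y => ENNReal.ofReal (y ^ m * mainardi q y)), ← lintegral_const_mul' _ _ ENNReal.ofReal_ne_top]
    refine setLIntegral_congr_fun measurableSet_Ioi fun x _ => ?_
    have hcancel : t ^ (q * m) * (t ^ (-q)) ^ m = 1 := by
      rw [← Real.rpow_mul_natCast ht'.le, ← Real.rpow_add ht']
      simp
    rw [← ENNReal.ofReal_mul ha.le, ← ENNReal.ofReal_mul (by positivity), add_sub_cancel_right,
      mul_pow, one_mul, mul_comm (t ^ (-q)) x]
    congr 1
    linear_combination (-(x ^ m * Real.exp (-t) * t ^ (-q) * mainardi q (x * t ^ (-q)))) * hcancel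
  rw [setLIntegral_congr_fun measurableSet_Ioi hleft, setLIntegral_congr_fun measurableSet_Ioi
    hright, hGamma _ (by positivity), Real.Gamma_nat_eq_factorial] at hswap
  rw [hswap, lintegral_mul_const'', hGamma _ (by positivity)]
  refine AEMeasurable.ennreal_ofReal (ContinuousOn.aemeasurable ?_ measurableSet_Ioi)
  exact (continuousOn_id.rpow_const fun t ht => Or.inl (ne_of_gt ht)).mul (by fun_prop)

theorem integrableOn_pow_mul_mainardi (hq0 : 0 < q) (hq1 : q < 1) (m : ℕ) :
    IntegrableOn (fun y => y ^ m * mainardi q y) (Ioi 0) := by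
  have h := lintegral_pow_mul_mainardi hq0 hq1 m
  have hG : 0 < Real.Gamma (q * m + 1) := Real.Gamma_pos_of_pos (by positivity)
  refine ⟨((by fun_prop : Continuous fun y : ℝ => y ^ m).continuousOn.mul
    ((continuousOn_mainardi hq0 hq1).mono Ioi_subset_Ici_self)).aestronglyMeasurable
    measurableSet_Ioi, ?_⟩
  rw [hasFiniteIntegral_iff_ofReal]
  · refine lt_top_iff_ne_top.2 fun htop => ?_
    rw [htop, ENNReal.mul_top (by simpa using hG)] at h
    exact ENNReal.ofReal_ne_top h.symm
  · filter_upwards [ae_restrict_mem measurableSet_Ioi] with y hy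
    exact mul_nonneg (pow_nonneg (le_of_lt hy) m) (mainardi_nonneg hq0 hq1 (le_of_lt hy))

theorem integral_pow_mul_mainardi (hq0 : 0 < q) (hq1 : q < 1) (m : ℕ) :
    ∫ y in Ioi (0 : ℝ), y ^ m * mainardi q y = m.factorial / Real.Gamma (q * m + 1) := by
  have h := lintegral_pow_mul_mainardi hq0 hq1 m
  have hG : 0 < Real.Gamma (q * m + 1) := Real.Gamma_pos_of_pos (by positivity)
  have hnn : ∀ y ∈ Ioi (0 : ℝ), 0 ≤ y ^ m * mainardi q y := fun y hy =>
    mul_nonneg (pow_nonneg (le_of_lt hy) m) (mainardi_nonneg hq0 hq1 (le_of_lt hy))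
  rw [← ofReal_integral_eq_lintegral_ofReal (integrableOn_pow_mul_mainardi hq0 hq1 m)
    ((ae_restrict_mem measurableSet_Ioi).mono hnn), ← ENNReal.ofReal_mul hG.le,
    ENNReal.ofReal_eq_ofReal_iff
      (mul_nonneg hG.le (setIntegral_nonneg measurableSet_Ioi hnn)) (by positivity)] at h
  rw [eq_div_iff hG.ne', mul_comm, h]

end Moments

/-! ### Estimates for cosine and sine families and for the time change -/

section CosineFamily

variable {X : Type*} [NormedAddCommGroup X] [NormedSpace ℝ X]

section Bounds

variable {C : ℝ → X →L[ℝ] X} {K : ℝ}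

theorem norm_apply_le_of_norm_le (hCK : ∀ t, ‖C t‖ ≤ K) (t : ℝ) (x : X) : ‖C t x‖ ≤ K * ‖x‖ :=
  (C t).le_of_opNorm_le (hCK t) x

theorem norm_sineFamily_le (hCK : ∀ t, ‖C t‖ ≤ K) {τ : ℝ} (hτ : 0 ≤ τ) (x : X) :
    ‖sineFamily C τ x‖ ≤ K * τ * ‖x‖ := by
  have h := intervalIntegral.norm_integral_le_of_norm_le_const (a := 0) (b := τ)
    (f := fun s => C s x) fun s _ => norm_apply_le_of_norm_le hCK s x
  rw [sub_zero, abs_of_nonneg hτ] at h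
  rw [sineFamily]
  linarith

theorem continuous_sineFamily (hC : IsCosineFamily C) (x : X) :
    Continuous fun τ => sineFamily C τ x :=
  intervalIntegral.continuous_primitive
    (fun _ _ => (hC.continuous_apply x).intervalIntegrable _ _) 0

variable {q : ℝ}

theorem integrableOn_mainardi_smul (hC : IsCosineFamily C) (hCK : ∀ t, ‖C t‖ ≤ K) (hq0 : 0 < q)
    (hq1 : q < 1) (τ : ℝ) (x : X) :
    IntegrableOn (fun θ => mainardi q θ • C (τ * θ) x) (Ioi 0) := by
  have hi := integrableOn_pow_mul_mainardi hq0 hq1 0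
  simp_rw [pow_zero, one_mul] at hi
  refine (hi.mul_const (K * ‖x‖)).mono' ?_ ?_
  · exact (((continuousOn_mainardi hq0 hq1).mono Ioi_subset_Ici_self).smul
      ((hC.continuous_apply x).comp (by fun_prop : Continuous fun θ : ℝ =>
        τ * θ)).continuousOn).aestronglyMeasurable measurableSet_Ioi
  · filter_upwards [ae_restrict_mem measurableSet_Ioi] with θ hθ
    have hM := mainardi_nonneg hq0 hq1 (le_of_lt hθ)
    rw [norm_smul, Real.norm_of_nonneg hM]
    exact mul_le_mul_of_nonneg_left (norm_apply_le_of_norm_le hCK _ x) hM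

theorem norm_integral_mainardi_smul_le (hCK : ∀ t, ‖C t‖ ≤ K) (hq0 : 0 < q)
    (hq1 : q < 1) (τ : ℝ) (x : X) :
    ‖∫ θ in Ioi (0 : ℝ), mainardi q θ • C (τ * θ) x‖ ≤ K * ‖x‖ := by
  have hi := integrableOn_pow_mul_mainardi hq0 hq1 0
  have hv := integral_pow_mul_mainardi hq0 hq1 0
  simp only [pow_zero, one_mul, Nat.factorial_zero, Nat.cast_one, Nat.cast_zero, mul_zero, zero_add,
    Real.Gamma_one, div_one] at hi hv
  refine (norm_integral_le_of_norm_le (hi.mul_const (K * ‖x‖)) ?_).trans (le_of_eq ?_)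
  · filter_upwards [ae_restrict_mem measurableSet_Ioi] with θ hθ
    have hM := mainardi_nonneg hq0 hq1 (le_of_lt hθ)
    rw [norm_smul, Real.norm_of_nonneg hM]
    exact mul_le_mul_of_nonneg_left (norm_apply_le_of_norm_le hCK _ x) hM
  · rw [integral_mul_const, hv, one_mul]

/-- Supplies the continuity in time that makes the integrand of `psiR` integrable. -/
theorem continuous_integral_mainardi_smul (hC : IsCosineFamily C) (hCK : ∀ t, ‖C t‖ ≤ K)
    (hq0 : 0 < q) (hq1 : q < 1) (x : X) :
    Continuous fun τ : ℝ => ∫ θ in Ioi (0 : ℝ), mainardi q θ • C (τ * θ) x := by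
  have hi := integrableOn_pow_mul_mainardi hq0 hq1 0
  simp_rw [pow_zero, one_mul] at hi
  refine continuous_of_dominated
    (fun τ => (integrableOn_mainardi_smul hC hCK hq0 hq1 τ x).aestronglyMeasurable)
    (fun τ => ?_) (hi.mul_const (K * ‖x‖)) (Filter.Eventually.of_forall fun θ => ?_)
  · filter_upwards [ae_restrict_mem measurableSet_Ioi] with θ hθ
    have hM := mainardi_nonneg hq0 hq1 (le_of_lt hθ)
    rw [norm_smul, Real.norm_of_nonneg hM]
    exact mul_le_mul_of_nonneg_left (norm_apply_le_of_norm_le hCK _ x) hM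
  · exact ((hC.continuous_apply x).comp (by fun_prop : Continuous fun τ : ℝ => τ * θ)).const_smul _

theorem norm_mul_mainardi_smul_sineFamily_le (hCK : ∀ t, ‖C t‖ ≤ K) (hq0 : 0 < q) (hq1 : q < 1)
    {τ θ : ℝ} (hτ : 0 ≤ τ) (hθ : 0 ≤ θ) (x : X) :
    ‖(q * θ * mainardi q θ) • sineFamily C (τ * θ) x‖ ≤
      θ ^ 2 * mainardi q θ * (q * K * τ * ‖x‖) := by
  have hM := mainardi_nonneg hq0 hq1 hθ
  rw [norm_smul, Real.norm_of_nonneg (by positivity)]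
  refine (mul_le_mul_of_nonneg_left (norm_sineFamily_le hCK (mul_nonneg hτ hθ) x)
    (by positivity)).trans (le_of_eq (by ring))

theorem integrableOn_mainardi_smul_sineFamily (hC : IsCosineFamily C) (hCK : ∀ t, ‖C t‖ ≤ K)
    (hq0 : 0 < q) (hq1 : q < 1) {τ : ℝ} (hτ : 0 ≤ τ) (x : X) :
    IntegrableOn (fun θ => (q * θ * mainardi q θ) • sineFamily C (τ * θ) x) (Ioi 0) := by
  refine ((integrableOn_pow_mul_mainardi hq0 hq1 2).mul_const (q * K * τ * ‖x‖)).mono' ?_ ?_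
  · refine (ContinuousOn.smul (ContinuousOn.mul (by fun_prop)
      ((continuousOn_mainardi hq0 hq1).mono Ioi_subset_Ici_self))
      ((continuous_sineFamily hC x).comp (by fun_prop : Continuous fun θ : ℝ =>
        τ * θ)).continuousOn).aestronglyMeasurable measurableSet_Ioi
  · filter_upwards [ae_restrict_mem measurableSet_Ioi] with θ hθ
    exact norm_mul_mainardi_smul_sineFamily_le hCK hq0 hq1 hτ (le_of_lt hθ) x

/-- The sine bound adds a second factor `θ`, so the second moment `2 / Γ(2q + 1) = 1 / (q Γ(2q))`
appears and cancels the prefactor `q`. -/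
theorem norm_integral_mainardi_smul_sineFamily_le (hCK : ∀ t, ‖C t‖ ≤ K) (hq0 : 0 < q)
    (hq1 : q < 1) {τ : ℝ} (hτ : 0 ≤ τ) (x : X) :
    ‖∫ θ in Ioi (0 : ℝ), (q * θ * mainardi q θ) • sineFamily C (τ * θ) x‖ ≤
      K * τ / Real.Gamma (2 * q) * ‖x‖ := by
  refine (norm_integral_le_of_norm_le
    ((integrableOn_pow_mul_mainardi hq0 hq1 2).mul_const (q * K * τ * ‖x‖)) ?_).trans (le_of_eq ?_)
  · filter_upwards [ae_restrict_mem measurableSet_Ioi] with θ hθ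
    exact norm_mul_mainardi_smul_sineFamily_le hCK hq0 hq1 hτ (le_of_lt hθ) x
  · have hG : 0 < Real.Gamma (2 * q) := Real.Gamma_pos_of_pos (by positivity)
    rw [integral_mul_const, integral_pow_mul_mainardi hq0 hq1 2, Nat.cast_ofNat, mul_comm q 2,
      Real.Gamma_add_one (by positivity)]
    simp only [Nat.factorial, Nat.cast_ofNat, mul_one, Nat.succ_eq_add_one, Nat.reduceAdd]
    field_simp

end Bounds

section TimeChange

variable {T : ℝ} {ψ ψ' : ℝ → ℝ}

theorem deriv_nonneg_of_strictMonoOn (hT : 0 < T) (hψ : StrictMonoOn ψ (Icc 0 T))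
    (hψ' : ∀ t ∈ Icc 0 T, HasDerivWithinAt ψ (ψ' t) (Icc 0 T) t) {t : ℝ} (ht : t ∈ Icc 0 T) :
    0 ≤ ψ' t := by
  rw [← (hψ' t ht).derivWithin (uniqueDiffOn_Icc hT t ht)]
  exact hψ.monotoneOn.derivWithin_nonneg

theorem integral_deriv_timeChange (hψ' : ∀ t ∈ Icc 0 T, HasDerivWithinAt ψ (ψ' t) (Icc 0 T) t)
    (hψc : ContinuousOn ψ' (Icc 0 T)) {t : ℝ} (ht0 : 0 ≤ t) (htT : t ≤ T) :
    ∫ r in (0 : ℝ)..t, ψ' r = ψ t - ψ 0 := by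
  have hsub : Icc 0 t ⊆ Icc 0 T := Icc_subset_Icc_right htT
  refine intervalIntegral.integral_eq_sub_of_hasDerivAt_of_le ht0
    (fun r hr => (hψ' r (hsub hr)).continuousWithinAt.mono hsub) (fun r hr => ?_)
    ((hψc.mono hsub).intervalIntegrable_of_Icc ht0)
  exact (hψ' r (hsub (Ioo_subset_Icc_self hr))).hasDerivAt
    (Icc_mem_nhds hr.1 (hr.2.trans_le htT))

theorem intervalIntegrable_deriv_smul (hψc : ContinuousOn ψ' (Icc 0 T)) {t : ℝ} (ht0 : 0 ≤ t)
    (htT : t ≤ T) {u : ℝ → X} (hu : ContinuousOn u (Icc 0 T)) :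
    IntervalIntegrable (fun r => (ψ' r / ψ' 0) • u r) volume 0 t :=
  (((hψc.div_const _).smul hu).mono (Icc_subset_Icc_right htT)).intervalIntegrable_of_Icc ht0

theorem norm_integral_deriv_smul_le (hT : 0 < T) (hψ : StrictMonoOn ψ (Icc 0 T))
    (hψ' : ∀ t ∈ Icc 0 T, HasDerivWithinAt ψ (ψ' t) (Icc 0 T) t)
    (hψc : ContinuousOn ψ' (Icc 0 T)) {t B : ℝ} (ht0 : 0 ≤ t) (htT : t ≤ T) {u : ℝ → X}
    (hB : ∀ r, ‖u r‖ ≤ B) :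
    ‖∫ r in (0 : ℝ)..t, (ψ' r / ψ' 0) • u r‖ ≤ B * ((ψ t - ψ 0) / ψ' 0) := by
  have hi : IntervalIntegrable (fun r => ψ' r / ψ' 0 * B) volume 0 t :=
    intervalIntegrable_deriv_smul hψc ht0 htT continuousOn_const
  refine (intervalIntegral.norm_integral_le_of_norm_le ht0 ?_ hi).trans (le_of_eq ?_)
  · refine Filter.Eventually.of_forall fun r hr => ?_
    have h0 := deriv_nonneg_of_strictMonoOn hT hψ hψ' (t := 0) ⟨le_rfl, hT.le⟩
    have hr' := deriv_nonneg_of_strictMonoOn hT hψ hψ' (t := r) ⟨hr.1.le, hr.2.trans htT⟩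
    rw [norm_smul, Real.norm_of_nonneg (div_nonneg hr' h0)]
    exact mul_le_mul_of_nonneg_left (hB r) (div_nonneg hr' h0)
  · rw [intervalIntegral.integral_mul_const, intervalIntegral.integral_div,
      integral_deriv_timeChange hψ' hψc ht0 htT, mul_comm]

end TimeChange

end CosineFamily

/-! ### The three bounds -/

theorem proposition3p1
    {X : Type*} [NormedAddCommGroup X] [NormedSpace ℝ X] [CompleteSpace X]
    (C : ℝ → X →L[ℝ] X) (hC : IsCosineFamily C)
    (K : ℝ) (hK : 1 ≤ K) (hCK : ∀ t : ℝ, ‖C t‖ ≤ K)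
    (T : ℝ) (hT : 0 < T) (ψ ψ' : ℝ → ℝ)
    (hψ : StrictMonoOn ψ (Icc 0 T))
    (hψ' : ∀ t ∈ Icc 0 T, HasDerivWithinAt ψ (ψ' t) (Icc 0 T) t)
    (hψc : ContinuousOn ψ' (Icc 0 T)) (hψ0 : ψ' 0 ≠ 0)
    (q : ℝ) (hq0 : 0 < q) (hq1 : q ≤ 1) :
    -- the series defining `M_q` converges
    (∀ z : ℝ, 0 ≤ z → Summable (mainardiTerm q z)) ∧
    ∀ (t s : ℝ) (x : X), 0 < s → s ≤ t → t ≤ T →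
      -- the integrals defining the three operators converge, and the bounds hold
      (IntegrableOn (fun θ => mainardi q θ • C ((ψ t - ψ 0) ^ q * θ) x) (Ioi 0) ∧
        ‖psiC C ψ q t x‖ ≤ K * ‖x‖) ∧
      (IntervalIntegrable (fun r => (ψ' r / ψ' 0) • psiC C ψ q r x) volume 0 t ∧
        ‖psiR C ψ ψ' q t x‖ ≤ K * ‖x‖ * ((ψ t - ψ 0) / ψ' 0)) ∧
      (IntegrableOn
          (fun θ => (q * θ * mainardi q θ) • sineFamily C ((ψ t - ψ s) ^ q * θ) x) (Ioi 0) ∧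
        ‖psiP C ψ q t s x‖ ≤ K * (ψ t - ψ s) ^ q / Real.Gamma (2 * q) * ‖x‖) ∧
      -- for `q = 1` the series `M_1` is zero; the bounds also hold when `M_1` is read as the
      -- Dirac mass at `1`
      (q = 1 →
        ‖C (ψ t - ψ 0) x‖ ≤ K * ‖x‖ ∧
        IntervalIntegrable (fun r => (ψ' r / ψ' 0) • C (ψ r - ψ 0) x) volume 0 t ∧
        ‖∫ r in (0 : ℝ)..t, (ψ' r / ψ' 0) • C (ψ r - ψ 0) x‖
          ≤ K * ‖x‖ * ((ψ t - ψ 0) / ψ' 0) ∧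
        ‖sineFamily C (ψ t - ψ s) x‖ ≤ K * (ψ t - ψ s) / Real.Gamma 2 * ‖x‖) := by
  refine ⟨fun z hz => summable_mainardiTerm hq0 hq1 hz, fun t s x hs hst htT => ?_⟩
  have ht0 : 0 ≤ t := hs.le.trans hst
  have hψcont : ContinuousOn ψ (Icc 0 T) := fun r hr => (hψ' r hr).continuousWithinAt
  have hψst : 0 ≤ ψ t - ψ s :=
    sub_nonneg.2 (hψ.monotoneOn ⟨hs.le, hst.trans htT⟩ ⟨ht0, htT⟩ hst)
  have hKx : 0 ≤ K * ‖x‖ := mul_nonneg (zero_le_one.trans hK) (norm_nonneg x)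
  have hcos : ∀ r, ‖psiC C ψ q r x‖ ≤ K * ‖x‖ := fun r => by
    -- At `q = 1` the integrand vanishes, and only `0 ≤ K * ‖x‖` is needed.
    rcases hq1.eq_or_lt with rfl | hq1
    · simpa [psiC, mainardi_one] using hKx
    · exact norm_integral_mainardi_smul_le hCK hq0 hq1 _ x
  have hcosc : ContinuousOn (fun r => psiC C ψ q r x) (Icc 0 T) := by
    rcases hq1.eq_or_lt with rfl | hq1
    · simpa [psiC, mainardi_one] using continuousOn_const
    · exact (continuous_integral_mainardi_smul hC hCK hq0 hq1 x).comp_continuousOn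
        ((hψcont.sub continuousOn_const).rpow_const fun _ _ => Or.inr hq0.le)
  refine ⟨⟨?_, hcos t⟩, ⟨intervalIntegrable_deriv_smul hψc ht0 htT hcosc,
    norm_integral_deriv_smul_le hT hψ hψ' hψc ht0 htT hcos⟩, ?_, fun _ => ⟨?_, ?_, ?_, ?_⟩⟩
  · rcases hq1.eq_or_lt with rfl | hq1
    · simp [mainardi_one]
    · exact integrableOn_mainardi_smul hC hCK hq0 hq1 _ x
  · have hτ : 0 ≤ (ψ t - ψ s) ^ q := Real.rpow_nonneg hψst q
    rcases hq1.eq_or_lt with rfl | hq1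
    · have hG : 0 < Real.Gamma (2 * 1) := Real.Gamma_pos_of_pos (by norm_num)
      refine ⟨by simp [mainardi_one], ?_⟩
      simp only [psiP, mainardi_one, mul_zero, zero_smul, integral_zero, norm_zero]
      positivity
    · exact ⟨integrableOn_mainardi_smul_sineFamily hC hCK hq0 hq1 hτ x,
        norm_integral_mainardi_smul_sineFamily_le hCK hq0 hq1 hτ x⟩
  · exact norm_apply_le_of_norm_le hCK _ x
  · exact intervalIntegrable_deriv_smul hψc ht0 htT
      ((hC.continuous_apply x).comp_continuousOn (hψcont.sub continuousOn_const))
  · exact norm_integral_deriv_smul_le hT hψ hψ' hψc ht0 htT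
      fun r => norm_apply_le_of_norm_le hCK _ x
  · rw [Real.Gamma_two, div_one]
    exact norm_sineFamily_le hCK hψst x
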